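/- Let $f=\sum_{i=0}^n a_i x^i\in\mathbb{Z}[x]$ be a square-free polynomial of degree $n$ (i.e. without multiple complex roots) with $|a_i|<2^\tau$ for all $i$, where $\tau\in\mathbb{N}$. For an interval $I=(a,b)$ let $w(I)=b-a$ and let $\operatorname{var}(f,I)$ be the number of sign variations in the coefficient sequence of $f_I(x)=(x+1)^n f\!\left(\frac{ax+b}{x+1}\right)$. The algorithm $\mathrm{Dsc}^2$ builds a recursion tree of pairs $(I,N_I)$, where $I$ is an open interval and $N_I=2^{2^{n_I}}$, $n_I\ge 1$. The root is $\mathcal I_0=(-2^{\tau+1},2^{\tau+1})$ with $N_{\mathcal I_0}=4$. A node $I=(a,b)$ with $v=\operatorname{var}(f,I)\le 1$ has no children and is called terminal. If $v>1$, the children of $I$ are determined as follows. (a) Let $B_1=(a,a+w(I)/N_I)$ and $B_2=(b-w(I)/N_I,b)$. If $\operatorname{var}(f,B_i)=v$ for some $i$ (this happens for at most one $i$), the only child is $B_i$, with $N_{B_i}=N_I^2$. (b) Otherwise, let $\lambda_1=a-v\frac{f(a)}{f'(a)}$, $\lambda_2=b-v\frac{f(b)}{f'(b)}$, $k_i=\min\bigl(\max\bigl(\bigl\lfloor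 4N_I\frac{\lambda_i-a}{b-a}\bigr\rfloor,2\bigr),4N_I-2\bigr)$ and $I_i'=\bigl(a+(k_i-2)\frac{w(I)}{4N_I},\,a+(k_i+2)\frac{w(I)}{4N_I}\bigr)$ (if the derivative vanishes at the endpoint in question, the corresponding test is regarded as failed). If $\operatorname{var}(f,I_i')=v$ for some $i\in\{1,2\}$, the only child is $I_i'$ for the smallest such $i$, with $N_{I_i'}=N_I^2$. (c) Otherwise, the children are $(a,\frac{a+b}2)$ and $(\frac{a+b}2,b)$, each with the number $\max(4,\sqrt{N_I})$. A non-terminal node $I$ is called special if it is the root or if $\operatorname{var}(f,I')<\operatorname{var}(f,I)$ for all children $I'$ of $I$. For a special node $J$, let $T_J$ be the set of all nodes $I$ that are neither terminal nor special and satisfy $J\subseteq I$ and $K\not\subseteq I$ for every special node $K\supsetneq J$. Then there is an absolute constant $C$ such that, for all $f$, $n$ and $\tau$ as above and every special node $J$ of the recursion tree, the set $T_J$ is finite and $$|T_J|\le C\,(\log n+\log\tau).$$ The same holds if, in (b), rounding down is replaced by rounding to the nearest integer (ties being rounded down), i.e. if $k_i\in\{2,\dots,4N_I-2\}$ is chosen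 such that $a+k_i\frac{w(I)}{4N_I}$ is closest to $\lambda_i$. -/

import Mathlib

namespace Dsc2

open Polynomial

noncomputable section

/-- The polynomial `f_I(x) = (x + 1)^n * f((a x + b) / (x + 1))` for `I = (a, b)`, with `n = deg f`,
that is, `∑ i, f_i (a x + b)^i (x + 1)^(n - i)`. -/
def mobius (f : ℝ[X]) (a b : ℝ) : ℝ[X] :=
  ∑ i ∈ Finset.range (f.natDegree + 1),
    C (f.coeff i) * (C a * X + C b) ^ i * (X + 1) ^ (f.natDegree - i)

/-- `var(f, I)` for `I = (a, b)`: the number of sign variations in the coefficient sequence of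
`f_I` (zero coefficients are skipped). -/
def var (f : ℝ[X]) (a b : ℝ) : ℕ := (mobius f a b).signVariations

/-- An active interval `I = (lo, hi)` together with the exponent `n_I = lvl`, which encodes
`N_I = 2 ^ 2 ^ n_I`. -/
@[ext]
structure Node where
  lo : ℝ
  hi : ℝ
  lvl : ℕ

namespace Node

/-- The open interval `I`. -/
def ival (I : Node) : Set ℝ := Set.Ioo I.lo I.hi

/-- The width `w(I)`. -/
def width (I : Node) : ℝ := I.hi - I.lo

/-- The integer `N_I = 2 ^ 2 ^ n_I`. -/
def N (I : Node) : ℕ := 2 ^ 2 ^ I.lvl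

/-- The number of sign variations of `f` on `I`. -/
def var (f : ℝ[X]) (I : Node) : ℕ := Dsc2.var f I.lo I.hi

/-- The leftmost subinterval of `I` of width `w(I) / N_I`, with `N_I` squared. -/
def leftEnd (I : Node) : Node := ⟨I.lo, I.lo + I.width / I.N, I.lvl + 1⟩

/-- The rightmost subinterval of `I` of width `w(I) / N_I`, with `N_I` squared. -/
def rightEnd (I : Node) : Node := ⟨I.hi - I.width / I.N, I.hi, I.lvl + 1⟩

/-- The index in `{2, …, 4 N_I - 2}` of the subdivision point `lo + k * w(I) / (4 N_I)` selected for
the approximation `l`; `rd` is the rule that rounds a real number to an integer. -/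
def newtonIndex (rd : ℝ → ℤ) (I : Node) (l : ℝ) : ℤ :=
  min (max (rd (4 * I.N * ((l - I.lo) / I.width))) 2) (4 * I.N - 2)

/-- The subinterval of `I` of width `w(I) / N_I` centred at the subdivision point selected for the
Newton iterate `t - v * f(t) / f'(t)`, `v = var(f, I)`, with `N_I` squared.
If `f'(t) = 0`, then the iterate evaluates to `t`. For an endpoint `t` of `I` this returns the
corresponding extreme subinterval, which the algorithm has already rejected at that moment, so that
the Newton test at `t` just fails. -/
def newton (rd : ℝ → ℤ) (f : ℝ[X]) (I : Node) (t : ℝ) : Node :=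
  let k : ℤ := newtonIndex rd I (t - I.var f * (f.eval t / f.derivative.eval t))
  ⟨I.lo + (k - 2) * (I.width / (4 * I.N)), I.lo + (k + 2) * (I.width / (4 * I.N)), I.lvl + 1⟩

/-- The left half of `I`, with `max (4, √N_I)` in place of `N_I`. -/
def leftHalf (I : Node) : Node := ⟨I.lo, (I.lo + I.hi) / 2, max 1 (I.lvl - 1)⟩

/-- The right half of `I`, with `max (4, √N_I)` in place of `N_I`. -/
def rightHalf (I : Node) : Node := ⟨(I.lo + I.hi) / 2, I.hi, max 1 (I.lvl - 1)⟩

/-- The children of `I` in the recursion tree: none if `var(f, I) ≤ 1`; otherwise the extreme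
subintervals are tried, then the two Newton subintervals, and finally `I` is bisected. -/
def children (rd : ℝ → ℤ) (f : ℝ[X]) (I : Node) : List Node :=
  let v := I.var f
  if v ≤ 1 then []
  else if I.leftEnd.var f = v then [I.leftEnd]
  else if I.rightEnd.var f = v then [I.rightEnd]
  else if (newton rd f I I.lo).var f = v then [newton rd f I I.lo]
  else if (newton rd f I I.hi).var f = v then [newton rd f I I.hi]
  else [I.leftHalf, I.rightHalf]

end Node

/-- The initial interval `(-2^(τ+1), 2^(τ+1))` with `N = 4`. -/
def root (τ : ℕ) : Node := ⟨-2 ^ (τ + 1), 2 ^ (τ + 1), 1⟩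

/-- The nodes of the recursion tree of the algorithm. -/
inductive InTree (rd : ℝ → ℤ) (f : ℝ[X]) (τ : ℕ) : Node → Prop
  | root : InTree rd f τ (root τ)
  | child {I J : Node} : InTree rd f τ I → J ∈ I.children rd f → InTree rd f τ J

/-- A node is terminal if it has at most one sign variation. -/
def IsTerminal (f : ℝ[X]) (I : Node) : Prop := I.var f ≤ 1

/-- A node of the recursion tree is special if it is non-terminal and either it is the root or all
its children have strictly fewer sign variations. -/
def IsSpecial (rd : ℝ → ℤ) (f : ℝ[X]) (τ : ℕ) (I : Node) : Prop :=
  InTree rd f τ I ∧ ¬ IsTerminal f I ∧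
    (I = root τ ∨ ∀ J ∈ I.children rd f, J.var f < I.var f)

/-- The chain belonging to a special node `J`: all non-terminal, non-special nodes `I ⊇ J` of the
recursion tree that contain no special node `K ⊋ J`. -/
def chain (rd : ℝ → ℤ) (f : ℝ[X]) (τ : ℕ) (J : Node) : Set Node :=
  {I | InTree rd f τ I ∧ ¬ IsTerminal f I ∧ ¬ IsSpecial rd f τ I ∧ J.ival ⊆ I.ival ∧
    ∀ K, IsSpecial rd f τ K → J.ival ⊂ K.ival → ¬ K.ival ⊆ I.ival}

/-- Rounding to the nearest integer, to the smaller one in case of a tie. -/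
def roundHalfDown (t : ℝ) : ℤ := ⌈t - 1 / 2⌉

end

end Dsc2

namespace Dsc2

open Polynomial

noncomputable section

/-! The nodes of `chain` lie on the path from the root to `J`, in the last stretch without special
nodes. Subadditivity of sign variations under subdivision (`var_add_var_le`) makes the number `v` of
variations constant on this stretch, so `run_length_le` only has to bound a run with constant `v`.

Measure a run on a logarithmic scale: `x` is the binary logarithm of the total shrinkage and `l` is
the level. A successful test adds `2 ^ l` to `x` and raises `l`; a bisection adds 1 and lowers `l`,
but never below 1. If bisections occur only within about `L + 2 ^ l` of the start or of the end of
the scale, there are `O(Λ + L)` steps, where `Λ` bounds the levels (`steps_le`). Root separation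
through the resultant (`separation`) bounds the widths from below and gives `Λ = O(log n + log τ)`.

It remains to see that tests fail only near the two ends. Obreshkoff-type bounds compare `v` with
the roots in a flat rhombus over the interval (`countP_inLens_le_var`) and with those in a disc of
radius `O(n w)` (`var_le_countP`). If a tiny interval and a large one around it have the same `v`,
both root counts equal `v`: the `v` roots form a cluster and all others are far away
(`exists_cluster`). The logarithmic derivative at the left endpoint is then dominated by the
cluster, and the Newton step of multiplicity `v` hits it (`newton_contains`), unless the current
width is within a factor `O(n ^ 2) N` of the first or the last width; hence `L = O(log n)`. The
argument needs a margin on both sides inside the large interval. As long as an endpoint of the run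
has not moved, the test of the extreme subinterval at that endpoint plays the role of the Newton
test. -/

/-! ### Sign variations of lists. -/

/-- The sequence of nonzero signs of a list of real numbers. -/
def signs (l : List ℝ) : List SignType := (l.map SignType.sign).filter (· ≠ 0)

/-- The number of maximal blocks of constant sign in a list of real numbers. -/
def blocks (l : List ℝ) : ℕ := ((signs l).destutter (· ≠ ·)).length

theorem signs_append (l₁ l₂ : List ℝ) : signs (l₁ ++ l₂) = signs l₁ ++ signs l₂ := by
  simp [signs]

theorem signs_singleton (x : ℝ) :
    signs [x] = if SignType.sign x = 0 then [] else [SignType.sign x] := by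
  by_cases h : SignType.sign x = 0 <;> simp [signs, h]

theorem signs_zero : signs [0] = [] := by simp [signs_singleton]

theorem signs_cons (x : ℝ) (l : List ℝ) : signs (x :: l) = signs [x] ++ signs l :=
  signs_append [x] l

/-- Destuttering produces a longest alternating subsequence; all lower bounds for `blocks` come from
this. -/
theorem length_le_blocks {d : List SignType} {l : List ℝ} (hd : d.IsChain (· ≠ ·))
    (h : d.Sublist (signs l)) : d.length ≤ blocks l :=
  hd.length_le_length_destutter_ne h

theorem blocks_mono {l₁ l₂ : List ℝ} (h : l₁.Sublist l₂) : blocks l₁ ≤ blocks l₂ :=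
  length_le_blocks (List.isChain_destutter _ _)
    ((List.destutter_sublist _ _).trans ((h.map _).filter _))

theorem blocks_reverse (l : List ℝ) : blocks l.reverse = blocks l := by
  have key : ∀ l : List ℝ, blocks l ≤ blocks l.reverse := by
    intro l
    have h1 : (((signs l).destutter (· ≠ ·)).reverse).IsChain (· ≠ ·) := by
      rw [List.isChain_reverse]
      have := List.isChain_destutter (R := fun a b : SignType => a ≠ b) (signs l)
      refine this.imp ?_
      intro a b h
      exact h.symm
    have h2 : (((signs l).destutter (· ≠ ·)).reverse).Sublist (signs l.reverse) := by
      have : signs l.reverse = (signs l).reverse := by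
        simp [signs, List.filter_reverse]
      rw [this]
      exact (List.destutter_sublist _ _).reverse
    simpa [blocks] using length_le_blocks h1 h2
  refine le_antisymm ?_ (key l)
  simpa using key l.reverse

theorem destutter'_dup {α : Type*} [DecidableEq α] (a x : α) (l₁ l₂ : List α) :
    (l₁ ++ x :: x :: l₂).destutter' (· ≠ ·) a = (l₁ ++ x :: l₂).destutter' (· ≠ ·) a := by
  induction l₁ generalizing a with
  | nil =>
    simp only [List.nil_append, List.destutter'_cons]
    by_cases h : a = x
    · subst h; simp
    · simp [h]
  | cons b l ih =>
    simp only [List.cons_append, List.destutter'_cons, ih]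

theorem destutter_dup {α : Type*} [DecidableEq α] (x : α) (l₁ l₂ : List α) :
    (l₁ ++ x :: x :: l₂).destutter (· ≠ ·) = (l₁ ++ x :: l₂).destutter (· ≠ ·) := by
  cases l₁ with
  | nil => simp [List.destutter]
  | cons b l => simpa [List.destutter] using! destutter'_dup b x l l₂

theorem blocks_dup (x : ℝ) (l₁ l₂ : List ℝ) :
    blocks (l₁ ++ x :: x :: l₂) = blocks (l₁ ++ x :: l₂) := by
  unfold blocks
  congr 1
  rw [signs_append, signs_append, signs_cons x (x :: l₂), signs_cons x l₂, signs_singleton]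
  split_ifs
  · simp
  · simpa using destutter_dup (SignType.sign x) (signs l₁) (signs l₂)

theorem sign_combination {s t : ℝ} (hs : 0 < s) (ht : 0 < t) (x y : ℝ) :
    SignType.sign (t * x + s * y) = 0 ∨
    SignType.sign (t * x + s * y) = SignType.sign x ∨
    SignType.sign (t * x + s * y) = SignType.sign y := by
  rcases lt_trichotomy (t * x + s * y) 0 with h | h | h
  · right
    by_cases hx : x < 0
    · left; rw [sign_neg h, sign_neg hx]
    · right
      have : y < 0 := by
        by_contra hy
        push Not at hx hy
        nlinarith [mul_nonneg ht.le hx, mul_nonneg hs.le hy]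
      rw [sign_neg h, sign_neg this]
  · left; simp [h]
  · right
    by_cases hx : 0 < x
    · left; rw [sign_pos h, sign_pos hx]
    · right
      have : 0 < y := by
        by_contra hy
        push Not at hx hy
        nlinarith [mul_nonneg_of_nonpos_of_nonpos hx (neg_nonpos.2 ht.le),
          mul_nonneg_of_nonpos_of_nonpos hy (neg_nonpos.2 hs.le)]
      rw [sign_pos h, sign_pos this]

/-- Inserting a positive combination of two neighbours creates no new sign variation. -/
theorem blocks_insert {s t : ℝ} (hs : 0 < s) (ht : 0 < t) (x y : ℝ) (l₁ l₂ : List ℝ) :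
    blocks (l₁ ++ x :: (t * x + s * y) :: y :: l₂) = blocks (l₁ ++ x :: y :: l₂) := by
  have hx := blocks_dup x l₁ (y :: l₂)
  have hy := blocks_dup y (l₁ ++ [x]) l₂
  simp only [List.append_assoc, List.cons_append, List.nil_append] at hy
  have e : ∀ z : ℝ, signs (l₁ ++ x :: z :: y :: l₂)
      = signs l₁ ++ (signs [x] ++ (signs [z] ++ (signs [y] ++ signs l₂))) := by
    intro z
    rw [signs_append, signs_cons x, signs_cons z, signs_cons y]
  have e2 : signs (l₁ ++ x :: y :: l₂)
      = signs l₁ ++ (signs [x] ++ (signs [y] ++ signs l₂)) := by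
    rw [signs_append, signs_cons x, signs_cons y]
  rcases sign_combination hs ht x y with h | h | h
  · unfold blocks
    rw [e, e2, signs_singleton (t * x + s * y), h]
    simp
  · rw [← hx]
    unfold blocks
    rw [e, e, signs_singleton (t * x + s * y), h, ← signs_singleton]
  · rw [← hy]
    unfold blocks
    rw [e, e, signs_singleton (t * x + s * y), h, ← signs_singleton]

/-- At most one block is lost, when the last block of `l₁` and the first block of `l₂` have the same
sign and merge. -/
theorem blocks_append (l₁ l₂ : List ℝ) : blocks l₁ + blocks l₂ ≤ blocks (l₁ ++ l₂) + 1 := by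
  set d₁ := (signs l₁).destutter (· ≠ ·) with hd₁
  set d₂ := (signs l₂).destutter (· ≠ ·) with hd₂
  have s₁ : d₁.Sublist (signs l₁) := List.destutter_sublist _ _
  have s₂ : d₂.Sublist (signs l₂) := List.destutter_sublist _ _
  have c₁ : d₁.IsChain (· ≠ ·) := List.isChain_destutter _ _
  have c₂ : d₂.IsChain (· ≠ ·) := List.isChain_destutter _ _
  have b₁ : blocks l₁ = d₁.length := rfl
  have b₂ : blocks l₂ = d₂.length := rfl
  rw [b₁, b₂]
  clear_value d₁ d₂
  rcases d₂ with _ | ⟨y, d⟩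
  · have := length_le_blocks (l := l₁ ++ l₂) c₁
      (by rw [signs_append]; exact s₁.trans (List.sublist_append_left _ _))
    simp only [List.length_nil]; omega
  by_cases h : y ∈ d₁.getLast?
  · have c : (d₁ ++ d).IsChain (· ≠ ·) := by
      rw [List.isChain_append]
      refine ⟨c₁, c₂.tail, ?_⟩
      intro x hx z hz
      obtain rfl : x = y := Option.mem_unique hx h
      rw [List.isChain_cons] at c₂
      exact c₂.1 z hz
    have := length_le_blocks (l := l₁ ++ l₂) c
      (by rw [signs_append]; exact s₁.append ((List.sublist_cons_self _ _).trans s₂))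
    simp only [List.length_append, List.length_cons] at this ⊢; omega
  · have c : (d₁ ++ (y :: d)).IsChain (· ≠ ·) := by
      rw [List.isChain_append]
      refine ⟨c₁, c₂, ?_⟩
      intro x hx z hz hxz
      simp only [List.head?_cons, Option.mem_def, Option.some.injEq] at hz
      exact h (by rw [hz, ← hxz]; exact hx)
    have := length_le_blocks (l := l₁ ++ l₂) c
      (by rw [signs_append]; exact s₁.append s₂)
    simp only [List.length_append, List.length_cons] at this ⊢; omega

theorem blocks_join (x : ℝ) (l₁ l₂ : List ℝ) :
    blocks (l₁ ++ [x]) + blocks (x :: l₂) ≤ blocks (l₁ ++ x :: l₂) + 1 := by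
  have := blocks_append (l₁ ++ [x]) (x :: l₂)
  simpa [blocks_dup] using this

/-- The list `[g 0, …, g m]`. -/
def row (g : ℕ → ℝ) (m : ℕ) : List ℝ := (List.range (m + 1)).map g

theorem row_succ_left (g : ℕ → ℝ) (m : ℕ) : row g (m + 1) = g 0 :: row (fun i => g (i + 1)) m := by
  rw [row, List.range_succ_eq_map, row]
  simp [Function.comp_def]

theorem row_succ_right (g : ℕ → ℝ) (m : ℕ) : row g (m + 1) = row g m ++ [g (m + 1)] := by
  rw [row, List.range_succ, row]
  simp

theorem blocks_row_congr {g h : ℕ → ℝ} {m : ℕ}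
    (H : ∀ i ≤ m, SignType.sign (g i) = SignType.sign (h i)) :
    blocks (row g m) = blocks (row h m) := by
  have : signs (row g m) = signs (row h m) := by
    unfold signs row
    rw [List.map_map, List.map_map]
    congr 1
    apply List.map_congr_left
    intro i hi
    exact H i (by simpa [Nat.lt_succ_iff] using hi)
  rw [blocks, this, blocks]

/-- Padding with zeros up to `m` is harmless, so polynomials of different degrees can be compared on
one range. The truncated subtraction gives the right value for `P = 0`. -/
theorem signVariations_eq_blocks (P : ℝ[X]) {m : ℕ} (h : P.natDegree ≤ m) :
    P.signVariations = blocks (row P.coeff m) - 1 := by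
  induction m, h using Nat.le_induction with
  | base =>
    by_cases hP : P = 0
    · simp [hP, row, blocks, signs]
    · rw [← blocks_reverse]
      have : (row P.coeff P.natDegree).reverse = P.coeffList := by
        rw [coeffList, withBotSucc_degree_eq_natDegree_add_one hP, row, List.map_reverse]
      rw [this]
      rfl
  | succ m hm ih =>
    rw [ih, row_succ_right]
    congr 1
    unfold blocks
    rw [signs_append, coeff_eq_zero_of_natDegree_lt (by omega), signs_zero, List.append_nil]

theorem signVariations_congr {P Q : ℝ[X]}
    (H : ∀ i, SignType.sign (P.coeff i) = SignType.sign (Q.coeff i)) :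
    P.signVariations = Q.signVariations := by
  rw [signVariations_eq_blocks P (le_max_left _ Q.natDegree),
    signVariations_eq_blocks Q (le_max_right P.natDegree _),
    blocks_row_congr (fun i _ => H i)]

/-! ### De Casteljau subdivision does not increase sign variations. -/

/-- One averaging step of de Casteljau's algorithm. -/
def avg (s t : ℝ) (g : ℕ → ℝ) : ℕ → ℝ := fun i => t * g i + s * g (i + 1)

/-- The concatenation of the two control polygons produced by de Casteljau's algorithm. -/
def casteljau (s t : ℝ) : ℕ → (ℕ → ℝ) → List ℝ
  | 0, g => [g 0]
  | m + 1, g => g 0 :: (casteljau s t m (avg s t g) ++ [g (m + 1)])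

/-- Inserting every average between its two neighbours keeps the number of blocks, and deleting the
inner original entries can only lower it. The induction interleaves both operations, which is why
`l₁` must vary. -/
theorem blocks_avg_le {s t : ℝ} (hs : 0 < s) (ht : 0 < t) (m : ℕ) (g : ℕ → ℝ) (l₁ l₂ : List ℝ) :
    blocks (l₁ ++ g 0 :: (row (avg s t g) m ++ g (m + 1) :: l₂))
      ≤ blocks (l₁ ++ (row g (m + 1) ++ l₂)) := by
  induction m generalizing g l₁ with
  | zero =>
    have := blocks_insert hs ht (g 0) (g 1) l₁ l₂
    simp only [row, avg, List.range_succ, List.range_zero, List.nil_append, List.map_cons,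
      List.map_nil, List.cons_append, zero_add] at this ⊢
    exact this.le
  | succ m ih =>
    rw [row_succ_left g, row_succ_left (avg s t g)]
    have h1 := ih (fun i => g (i + 1)) (l₁ ++ [g 0, avg s t g 0])
    have h2 := blocks_insert hs ht (g 0) (g 1) l₁ (row (fun i => g (i + 1 + 1)) m ++ l₂)
    simp only [List.append_assoc, List.cons_append, List.nil_append] at h1 ⊢
    calc _ ≤ _ := blocks_mono ?_
      _ ≤ _ := h1
      _ ≤ _ := ?_
    · refine List.Sublist.append_left ?_ _
      refine List.Sublist.cons_cons _ (List.Sublist.cons_cons _ ?_)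
      exact List.sublist_cons_self _ _
    · rw [row_succ_left]
      simp only [zero_add, List.cons_append] at h2 ⊢
      exact h2.le

theorem blocks_casteljau_le {s t : ℝ} (hs : 0 < s) (ht : 0 < t) (m : ℕ) (g : ℕ → ℝ)
    (l₁ l₂ : List ℝ) :
    blocks (l₁ ++ (casteljau s t m g ++ l₂)) ≤ blocks (l₁ ++ (row g m ++ l₂)) := by
  induction m generalizing g l₁ l₂ with
  | zero => simp [casteljau, row]
  | succ m ih =>
    refine le_trans ?_ (blocks_avg_le hs ht m g l₁ l₂)
    have := ih (avg s t g) (l₁ ++ [g 0]) (g (m + 1) :: l₂)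
    simpa [casteljau] using this

theorem casteljau_eq (s t : ℝ) (m : ℕ) (g : ℕ → ℝ) :
    casteljau s t m g = (List.range m).map (fun j => (avg s t)^[j] g 0) ++
      row (fun k => (avg s t)^[m - k] g k) m := by
  induction m generalizing g with
  | zero => simp [casteljau, row]
  | succ m ih =>
    rw [casteljau, ih, row_succ_right, List.range_succ_eq_map]
    simp only [List.map_cons, Function.iterate_zero, id, List.map_map, Function.comp_def,
      Function.iterate_succ, List.append_assoc, List.cons_append, Nat.sub_self]
    congr 3
    unfold row
    apply List.map_congr_left
    intro k hk
    have hk : k ≤ m := by simpa [Nat.lt_succ_iff] using hk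
    rw [Nat.succ_sub hk, Function.iterate_succ, Function.comp]

/-- The two control polygons share the entry `(avg s t)^[m] g 0`, so joining them loses at most one
block, which one of the two subtractions on the left pays for. -/
theorem blocks_two_polygons_le {s t : ℝ} (hs : 0 < s) (ht : 0 < t) (m : ℕ) (g : ℕ → ℝ) :
    (blocks (row (fun k => (avg s t)^[k] g 0) m) - 1) +
      (blocks (row (fun k => (avg s t)^[m - k] g k) m) - 1) ≤ blocks (row g m) - 1 := by
  have h := blocks_casteljau_le hs ht m g [] []
  simp only [List.nil_append, List.append_nil, casteljau_eq] at h
  have h1 : row (fun k => (avg s t)^[k] g 0) m =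
      (List.range m).map (fun k => (avg s t)^[k] g 0) ++ [(avg s t)^[m] g 0] := by
    rw [row, List.range_succ]; simp
  obtain ⟨r, hr⟩ : ∃ r, row (fun k => (avg s t)^[m - k] g k) m = (avg s t)^[m] g 0 :: r := by
    refine ⟨(List.range m).map (fun k => (avg s t)^[m - (k + 1)] g (k + 1)), ?_⟩
    rw [row, List.range_succ_eq_map]
    simp [Function.comp_def]
  rw [hr] at h ⊢
  rw [h1]
  have h2 := blocks_join ((avg s t)^[m] g 0) ((List.range m).map (fun k => (avg s t)^[k] g 0)) r
  have h3 : blocks ((List.range m).map (fun k => (avg s t)^[k] g 0) ++ [(avg s t)^[m] g 0]) ≤ _ :=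
    blocks_mono (List.Sublist.append_left
      (List.singleton_sublist.2 List.mem_cons_self) _) |>.trans h
  have h4 : blocks ((avg s t)^[m] g 0 :: r) ≤ _ :=
    (blocks_mono (List.sublist_append_right _ _)).trans h
  omega

theorem avg_iterate (s t : ℝ) (j : ℕ) (g : ℕ → ℝ) (i : ℕ) :
    (avg s t)^[j] g i =
      ∑ l ∈ Finset.range (j + 1), (j.choose l : ℝ) * s ^ l * t ^ (j - l) * g (i + l) := by
  induction j generalizing g with
  | zero => simp
  | succ j ih =>
    rw [Function.iterate_succ, Function.comp, ih]
    simp only [avg]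
    rw [Finset.sum_range_succ' _ (j + 1)]
    have e1 : ∀ l ∈ Finset.range (j + 1), ((j + 1).choose (l + 1) : ℝ) * s ^ (l + 1) *
        t ^ (j + 1 - (l + 1)) * g (i + (l + 1)) =
        (j.choose l : ℝ) * s ^ l * t ^ (j - l) * (s * g (i + l + 1)) +
        (j.choose (l + 1) : ℝ) * s ^ (l + 1) * t ^ (j - l) * g (i + (l + 1)) := by
      intro l _
      rw [Nat.choose_succ_succ, Nat.add_sub_add_right, ← add_assoc]
      push_cast
      ring
    rw [Finset.sum_congr rfl e1, Finset.sum_add_distrib, add_assoc]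
    have e2 : ∑ l ∈ Finset.range (j + 1),
        (j.choose (l + 1) : ℝ) * s ^ (l + 1) * t ^ (j - l) * g (i + (l + 1)) +
        ((j + 1).choose 0 : ℝ) * s ^ 0 * t ^ (j + 1 - 0) * g (i + 0) =
        ∑ l ∈ Finset.range (j + 1), (j.choose l : ℝ) * s ^ l * t ^ (j - l) * (t * g (i + l)) := by
      rw [Finset.sum_range_succ, Finset.sum_range_succ' _ j]
      simp only [Nat.choose_succ_self, Nat.cast_zero, zero_mul, add_zero]
      congr 1
      · apply Finset.sum_congr rfl
        intro l hl
        have hl : l < j := by simpa using hl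
        have : j - l = (j - (l + 1)) + 1 := by omega
        rw [this, pow_succ]
        ring
      · simp [pow_succ]; ring
    rw [e2, ← Finset.sum_add_distrib]
    apply Finset.sum_congr rfl
    intro l _
    ring

/-! ### Bernstein coefficients and subadditivity of `var`. -/

theorem natDegree_mobius_le (f : ℝ[X]) (a b : ℝ) : (mobius f a b).natDegree ≤ f.natDegree := by
  unfold mobius
  refine natDegree_sum_le_of_forall_le _ _ ?_
  intro i hi
  have hi : i ≤ f.natDegree := by simpa [Nat.lt_succ_iff] using hi
  have h1 : (C a * X + C b : ℝ[X]).natDegree ≤ 1 := natDegree_linear_le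
  have h2 : (X + 1 : ℝ[X]).natDegree ≤ 1 := by
    have := natDegree_X_add_C (1 : ℝ)
    simpa using this.le
  calc _ ≤ (C (f.coeff i) * (C a * X + C b) ^ i).natDegree
        + ((X + 1 : ℝ[X]) ^ (f.natDegree - i)).natDegree := natDegree_mul_le
    _ ≤ (0 + i * 1) + (f.natDegree - i) * 1 := by
        gcongr
        · exact natDegree_mul_le.trans (add_le_add (natDegree_C _).le
            (natDegree_pow_le_of_le i h1))
        · exact natDegree_pow_le_of_le _ h2
    _ = f.natDegree := by omega

/-- Evaluation of `mobius f a b` at `u / v`, with denominators cleared. -/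
theorem sum_coeff_mobius (f : ℝ[X]) (a b u : ℝ) {v : ℝ} (hv : v ≠ 0) :
    ∑ i ∈ Finset.range (f.natDegree + 1), (mobius f a b).coeff i * u ^ i * v ^ (f.natDegree - i) =
      ∑ i ∈ Finset.range (f.natDegree + 1),
        f.coeff i * (a * u + b * v) ^ i * (u + v) ^ (f.natDegree - i) := by
  have h1 : ∑ i ∈ Finset.range (f.natDegree + 1),
      (mobius f a b).coeff i * u ^ i * v ^ (f.natDegree - i) =
      v ^ f.natDegree * (mobius f a b).eval (u / v) := by
    rw [eval_eq_sum_range' (Nat.lt_succ_of_le (natDegree_mobius_le f a b)), Finset.mul_sum]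
    apply Finset.sum_congr rfl
    intro i hi
    have hi : i ≤ f.natDegree := by simpa [Nat.lt_succ_iff] using hi
    rw [pow_sub₀ _ hv hi, div_pow]
    ring
  rw [h1, mobius, eval_finsetSum, Finset.mul_sum]
  apply Finset.sum_congr rfl
  intro i hi
  have hi : i ≤ f.natDegree := by simpa [Nat.lt_succ_iff] using hi
  simp only [eval_mul, eval_pow, eval_add, eval_C, eval_X, eval_one]
  have e1 : a * u + b * v = (a * (u / v) + b) * v := by field_simp
  have e2 : u + v = (u / v + 1) * v := by field_simp
  rw [e1, e2, mul_pow, mul_pow, ← Nat.add_sub_of_le hi, pow_add]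
  simp only [add_tsub_cancel_left]
  ring

/-- Passing to the left subinterval is the substitution `x ↦ (x + s) / t` in `mobius f a b`, up to a
power of `t`; for the right one it is `x ↦ s x / (t x + 1)`. -/
theorem mobius_left (f : ℝ[X]) (a b : ℝ) {s t : ℝ} (ht : 0 < t) (hst : s + t = 1) :
    mobius f a (s * a + t * b) = ∑ i ∈ Finset.range (f.natDegree + 1),
      C ((mobius f a b).coeff i * t ^ (f.natDegree - i)) * (X + C s) ^ i := by
  apply Polynomial.funext
  intro x
  have h := sum_coeff_mobius f a b (x + s) ht.ne'
  simp only [mobius, eval_finsetSum, eval_mul, eval_pow, eval_add, eval_C, eval_X, eval_one] at h ⊢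
  rw [show a * (x + s) + b * t = a * x + (s * a + t * b) by ring,
    show x + s + t = x + 1 by rw [← hst]; ring] at h
  rw [← h]
  apply Finset.sum_congr rfl
  intro i _
  ring

theorem mobius_right (f : ℝ[X]) (a b : ℝ) {s t : ℝ} (ht : 0 < t) (hst : s + t = 1) :
    mobius f (s * a + t * b) b = ∑ i ∈ Finset.range (f.natDegree + 1),
      C ((mobius f a b).coeff i * s ^ i) * (X ^ i * (C t * X + 1) ^ (f.natDegree - i)) := by
  -- Restricting to `x > 0` keeps the denominator `t * x + 1` nonzero.
  apply Polynomial.eq_of_infinite_eval_eq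
  apply (Set.Ioi_infinite (0 : ℝ)).mono
  intro x hx
  have hx : 0 < x := hx
  have h := sum_coeff_mobius f a b (s * x) (v := t * x + 1) (by positivity)
  simp only [mobius, eval_finsetSum, eval_mul, eval_pow, eval_add, eval_C, eval_X, eval_one,
    Set.mem_ofPred_eq] at h ⊢
  rw [show a * (s * x) + b * (t * x + 1) = (s * a + t * b) * x + b by ring,
    show s * x + (t * x + 1) = x + 1 by rw [← add_assoc, ← add_mul, hst, one_mul]] at h
  rw [← h]
  apply Finset.sum_congr rfl
  intro i _
  ring

/-- The coefficients of `mobius f a b` with the binomial factors removed, that is, the Bernstein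
coefficients of `f` on `(a, b)`. -/
def bern (f : ℝ[X]) (a b : ℝ) (i : ℕ) : ℝ := (mobius f a b).coeff i / (f.natDegree.choose i : ℝ)

theorem coeff_eq_choose_mul_bern (f : ℝ[X]) (a b : ℝ) {i : ℕ} (hi : i ≤ f.natDegree) :
    (mobius f a b).coeff i = (f.natDegree.choose i : ℝ) * bern f a b i := by
  have : (f.natDegree.choose i : ℝ) ≠ 0 := by exact_mod_cast (Nat.choose_pos hi).ne'
  rw [bern]; field_simp

/-- Once the binomial factors are removed, subdivision acts on coefficients by de Casteljau's
algorithm; `hc` is the binomial identity that moves these factors out. -/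
theorem coeff_mobius_left (f : ℝ[X]) (a b : ℝ) {s t : ℝ} (ht : 0 < t)
    (hst : s + t = 1) {k : ℕ} (hk : k ≤ f.natDegree) :
    (mobius f a (s * a + t * b)).coeff k =
      (f.natDegree.choose k : ℝ) * (avg s t)^[f.natDegree - k] (bern f a b) k := by
  set n := f.natDegree with hn
  rw [mobius_left f a b ht hst, finsetSum_coeff, avg_iterate, ← hn, Finset.mul_sum]
  have hle : n + 1 = k + (n - k + 1) := by omega
  rw [hle, Finset.sum_range_add]
  have h0 : ∑ x ∈ Finset.range k,
      (C ((mobius f a b).coeff x * t ^ (n - x)) * (X + C s) ^ x).coeff k = 0 := by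
    apply Finset.sum_eq_zero
    intro i hi
    have hi : i < k := by simpa using hi
    rw [coeff_C_mul, coeff_X_add_C_pow, Nat.choose_eq_zero_of_lt hi]
    simp
  rw [h0, zero_add]
  apply Finset.sum_congr rfl
  intro l hl
  have hl : l ≤ n - k := by simpa [Nat.lt_succ_iff] using hl
  rw [coeff_C_mul, coeff_X_add_C_pow, coeff_eq_choose_mul_bern f a b (by omega), ← hn]
  have hc : (n.choose (k + l) : ℝ) * ((k + l).choose k : ℝ)
      = (n.choose k : ℝ) * ((n - k).choose l : ℝ) := by
    have := Nat.choose_mul (n := n) (k := k + l) (s := k) (by omega)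
    rw [Nat.add_sub_cancel_left] at this
    exact_mod_cast this
  rw [Nat.add_sub_cancel_left, Nat.sub_add_eq]
  linear_combination (bern f a b (k + l) * t ^ (n - k - l) * s ^ l) * hc

theorem coeff_mobius_right (f : ℝ[X]) (a b : ℝ) {s t : ℝ} (ht : 0 < t)
    (hst : s + t = 1) {k : ℕ} (hk : k ≤ f.natDegree) :
    (mobius f (s * a + t * b) b).coeff k =
      (f.natDegree.choose k : ℝ) * (avg s t)^[k] (bern f a b) 0 := by
  set n := f.natDegree with hn
  rw [mobius_right f a b ht hst, finsetSum_coeff, avg_iterate, ← hn, Finset.mul_sum]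
  have hle : n + 1 = (k + 1) + (n - k) := by omega
  rw [hle, Finset.sum_range_add]
  have h0 : ∑ x ∈ Finset.range (n - k),
      (C ((mobius f a b).coeff (k + 1 + x) * s ^ (k + 1 + x)) *
        (X ^ (k + 1 + x) * (C t * X + 1) ^ (n - (k + 1 + x)))).coeff k = 0 := by
    apply Finset.sum_eq_zero
    intro i hi
    rw [coeff_C_mul, coeff_X_pow_mul']
    rw [if_neg (by omega), mul_zero]
  rw [h0, add_zero]
  apply Finset.sum_congr rfl
  intro i hi
  have hi : i ≤ k := by simpa [Nat.lt_succ_iff] using hi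
  have hlin : ((C t * X + 1 : ℝ[X]) ^ (n - i)).coeff (k - i)
      = t ^ (k - i) * ((n - i).choose (k - i) : ℝ) := by
    have : (C t * X + 1 : ℝ[X]) ^ (n - i) = ((X + C (1 : ℝ)) ^ (n - i)).comp (C t * X) := by
      simp
    rw [this, comp_C_mul_X_coeff, coeff_X_add_C_pow, one_pow, one_mul]
    ring
  rw [coeff_C_mul, coeff_X_pow_mul', if_pos hi, hlin,
    coeff_eq_choose_mul_bern f a b (by omega), ← hn, zero_add]
  have hc : (n.choose k : ℝ) * (k.choose i : ℝ)
      = (n.choose i : ℝ) * ((n - i).choose (k - i) : ℝ) := by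
    exact_mod_cast Nat.choose_mul (n := n) (k := k) (s := i) hi
  linear_combination -(bern f a b i * t ^ (k - i) * s ^ i) * hc

theorem sign_choose_mul {n k : ℕ} (h : k ≤ n) (x : ℝ) :
    SignType.sign ((n.choose k : ℝ) * x) = SignType.sign x := by
  have : (0 : ℝ) < n.choose k := by exact_mod_cast Nat.choose_pos h
  rw [sign_mul, sign_pos this, one_mul]

theorem var_eq_blocks (f : ℝ[X]) (a b : ℝ) :
    var f a b = blocks (row (mobius f a b).coeff f.natDegree) - 1 :=
  signVariations_eq_blocks _ (natDegree_mobius_le f a b)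

/-- The number of sign variations is subadditive under subdivision of an interval. -/
theorem var_add_var_le (f : ℝ[X]) {a m b : ℝ} (ham : a < m) (hmb : m < b) :
    var f a m + var f m b ≤ var f a b := by
  set t := (m - a) / (b - a) with ht
  set s := (b - m) / (b - a) with hs
  have hba : 0 < b - a := by linarith
  have ht0 : 0 < t := div_pos (by linarith) hba
  have hs0 : 0 < s := div_pos (by linarith) hba
  have hst : s + t = 1 := by rw [hs, ht]; field_simp; ring
  have hm : m = s * a + t * b := by rw [hs, ht]; field_simp; ring
  rw [hm, var_eq_blocks, var_eq_blocks, var_eq_blocks f a b]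
  rw [blocks_row_congr (g := (mobius f a (s * a + t * b)).coeff)
      (h := fun k => (avg s t)^[f.natDegree - k] (bern f a b) k)
      (fun i hi => by rw [coeff_mobius_left f a b ht0 hst hi, sign_choose_mul hi]),
    blocks_row_congr (g := (mobius f (s * a + t * b) b).coeff)
      (h := fun k => (avg s t)^[k] (bern f a b) 0)
      (fun i hi => by rw [coeff_mobius_right f a b ht0 hst hi, sign_choose_mul hi]),
    blocks_row_congr (g := (mobius f a b).coeff) (h := bern f a b)
      (fun i hi => by rw [coeff_eq_choose_mul_bern f a b hi, sign_choose_mul hi])]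
  have := blocks_two_polygons_le hs0 ht0 f.natDegree (bern f a b)
  omega

theorem var_mono (f : ℝ[X]) {a b a' b' : ℝ} (ha : a ≤ a') (hab : a' < b') (hb : b' ≤ b) :
    var f a' b' ≤ var f a b := by
  have h1 : var f a' b' ≤ var f a b' := by
    rcases ha.eq_or_lt with rfl | ha
    · exact le_rfl
    · have := var_add_var_le f ha hab
      omega
  have h2 : var f a b' ≤ var f a b := by
    rcases hb.eq_or_lt with rfl | hb
    · exact le_rfl
    · have := var_add_var_le f (ha.trans_lt hab) hb
      omega
  omega

/-! ### Obreshkoff bounds: roots in sectors and sign variations. -/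

/-- The polynomial `P` with its `i`-th coefficient multiplied by `c i`. -/
def scaleCoeff (c : ℕ → ℝ) (P : ℝ[X]) : ℝ[X] :=
  ∑ i ∈ Finset.range (P.natDegree + 1), monomial i (c i * P.coeff i)

theorem coeff_scaleCoeff (c : ℕ → ℝ) (P : ℝ[X]) (i : ℕ) :
    (scaleCoeff c P).coeff i = c i * P.coeff i := by
  rw [scaleCoeff, finsetSum_coeff]
  simp only [coeff_monomial]
  rw [Finset.sum_ite_eq']
  split_ifs with h
  · rfl
  · rw [coeff_eq_zero_of_natDegree_lt (by simpa using h), mul_zero]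

theorem sign_coeff_scaleCoeff {c : ℕ → ℝ} {P : ℝ[X]} (hc : ∀ i ≤ P.natDegree, 0 < c i) (i : ℕ) :
    SignType.sign ((scaleCoeff c P).coeff i) = SignType.sign (P.coeff i) := by
  rw [coeff_scaleCoeff]
  by_cases h : i ≤ P.natDegree
  · rw [sign_mul, sign_pos (hc i h), one_mul]
  · rw [coeff_eq_zero_of_natDegree_lt (by omega), mul_zero]

theorem ne_zero_of_sign_coeff {P Q : ℝ[X]}
    (H : ∀ i, SignType.sign (P.coeff i) = SignType.sign (Q.coeff i)) (hQ : Q ≠ 0) : P ≠ 0 := by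
  rintro rfl
  apply hQ
  ext i
  have := H i
  simpa using this.symm

theorem coeff_X_sub_one_mul (P : ℝ[X]) (k : ℕ) :
    ((X - C 1) * P).coeff k = (X * P).coeff k - P.coeff k := by
  rw [sub_mul, coeff_sub, coeff_C_mul, one_mul]

/-- Multiplication by `X² - 2 cos θ X + 1` adds at least two sign variations if `θ` is small. -/
theorem signVariations_add_two_le_unit {P : ℝ[X]} (hP : P ≠ 0) {θ : ℝ} (hθ : 0 < θ)
    (hd : (P.natDegree + 3) * θ < Real.pi) :
    P.signVariations + 2 ≤ ((X ^ 2 - C (2 * Real.cos θ) * X + C 1) * P).signVariations := by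
  set d := P.natDegree with hdef
  have hpos : ∀ k : ℕ, 1 ≤ k → k ≤ d + 3 → 0 < Real.sin (k * θ) := by
    intro k hk hk'
    apply Real.sin_pos_of_pos_of_lt_pi
    · have : (0 : ℝ) < k := by exact_mod_cast hk
      positivity
    · refine lt_of_le_of_lt ?_ hd
      gcongr
      exact_mod_cast hk'
  -- The second-order difference operator given by `X² - 2 cos θ X + 1` is factored into two
  -- first-order ones with positive rescalings by its solution `sin (k θ)`. Each multiplication by
  -- `X - 1` gains one sign variation by the Descartes inequality, and the rescalings gain or lose
  -- none. The largest sine argument is `(d + 3) θ`, whence the hypothesis `hd`.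
  set S := scaleCoeff (fun k => (Real.sin ((k + 2 : ℕ) * θ))⁻¹) P with hS
  have hSs := sign_coeff_scaleCoeff (c := fun k => (Real.sin ((k + 2 : ℕ) * θ))⁻¹) (P := P)
    (fun i hi => inv_pos.2 (hpos _ (by omega) (by omega)))
  have hS0 : S ≠ 0 := ne_zero_of_sign_coeff hSs hP
  have hSdeg : S.natDegree ≤ d := by
    rw [natDegree_le_iff_coeff_eq_zero]
    intro i hi
    rw [hS, coeff_scaleCoeff, coeff_eq_zero_of_natDegree_lt hi, mul_zero]
  set U := (X - C 1) * S with hU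
  have hU0 : U ≠ 0 := mul_ne_zero (X_sub_C_ne_zero _) hS0
  have hUdeg : U.natDegree ≤ d + 1 := by
    rw [hU, natDegree_mul (X_sub_C_ne_zero _) hS0, natDegree_X_sub_C]
    omega
  set T := scaleCoeff (fun k => Real.sin ((k + 2 : ℕ) * θ) * Real.sin ((k + 1 : ℕ) * θ)) U with hT
  have hTs := sign_coeff_scaleCoeff
    (c := fun k => Real.sin ((k + 2 : ℕ) * θ) * Real.sin ((k + 1 : ℕ) * θ)) (P := U)
    (fun i hi => mul_pos (hpos _ (by omega) (by omega)) (hpos _ (by omega) (by omega)))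
  have hT0 : T ≠ 0 := ne_zero_of_sign_coeff hTs hU0
  set Q := (X ^ 2 - C (2 * Real.cos θ) * X + C 1) * P with hQ
  have hQdeg : Q.natDegree ≤ d + 2 := by
    have : (X ^ 2 - C (2 * Real.cos θ) * X + C 1 : ℝ[X]).natDegree ≤ 2 := by compute_degree
    exact natDegree_mul_le.trans (by omega)
  have hscoeff : ∀ k, P.coeff k = Real.sin ((k + 2 : ℕ) * θ) * S.coeff k := by
    intro k
    rw [hS, coeff_scaleCoeff]
    by_cases hk : k ≤ d
    · have := hpos (k + 2) (by omega) (by omega)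
      field_simp
    · rw [coeff_eq_zero_of_natDegree_lt (by omega)]; simp
  have key : ∀ k, ((X - C 1) * T).coeff k = Real.sin ((k + 1 : ℕ) * θ) * Q.coeff k := by
    intro k
    have hQk : Q.coeff k = (X * (X * P)).coeff k - 2 * Real.cos θ * (X * P).coeff k
        + P.coeff k := by
      rw [hQ, show (X ^ 2 - C (2 * Real.cos θ) * X + C 1) * P =
        X * (X * P) - C (2 * Real.cos θ) * (X * P) + P by rw [C_1]; ring]
      rw [coeff_add, coeff_sub, coeff_C_mul]
    rw [coeff_X_sub_one_mul, hQk]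
    have hTk : ∀ j, T.coeff j = Real.sin ((j + 2 : ℕ) * θ) * Real.sin ((j + 1 : ℕ) * θ)
        * ((X * S).coeff j - S.coeff j) := by
      intro j
      rw [hT, coeff_scaleCoeff, hU, coeff_X_sub_one_mul]
    have hrec : ∀ j : ℕ, Real.sin ((j + 2 : ℕ) * θ) =
        2 * Real.cos θ * Real.sin ((j + 1 : ℕ) * θ) - Real.sin (j * θ) := by
      intro j
      have e1 : ((j + 2 : ℕ) : ℝ) * θ = (j + 1 : ℕ) * θ + θ := by push_cast; ring
      have e2 : ((j : ℕ) : ℝ) * θ = (j + 1 : ℕ) * θ - θ := by push_cast; ring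
      rw [e1, e2, Real.sin_add, Real.sin_sub]
      ring
    rw [hTk k]
    rcases k with _ | _ | k
    · simp only [mul_coeff_zero, coeff_X_zero, zero_mul, hscoeff 0]
      ring
    · simp only [coeff_X_mul, mul_coeff_zero, coeff_X_zero, zero_mul, hTk 0, hscoeff 0, hscoeff 1,
        zero_add]
      have := hrec 1
      norm_num at this ⊢
      rw [this]
      ring
    · simp only [coeff_X_mul, hTk, hscoeff]
      have := hrec (k + 2)
      simp only [add_assoc] at this ⊢
      norm_num only [Nat.reduceAdd] at this ⊢
      rw [this]
      ring
  have hsgn : ((X - C 1) * T).signVariations = Q.signVariations := by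
    apply signVariations_congr
    intro k
    rw [key]
    by_cases hk : k ≤ d + 2
    · rw [sign_mul, sign_pos (hpos _ (by omega) (by omega)), one_mul]
    · rw [coeff_eq_zero_of_natDegree_lt (by omega), mul_zero]
  have i1 := succ_signVariations_le_X_sub_C_mul one_pos hS0
  have i2 := succ_signVariations_le_X_sub_C_mul one_pos hT0
  rw [hsgn, signVariations_congr hTs] at i2
  rw [signVariations_congr hSs, ← hU] at i1
  omega

theorem signVariations_comp_C_mul_X (P : ℝ[X]) {r : ℝ} (hr : 0 < r) :
    (P.comp (C r * X)).signVariations = P.signVariations := by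
  apply signVariations_congr
  intro i
  rw [comp_C_mul_X_coeff, sign_mul, sign_pos (pow_pos hr i), mul_one]

theorem signVariations_add_two_le {P : ℝ[X]} (hP : P ≠ 0) {θ r : ℝ} (hθ : 0 < θ) (hr : 0 < r)
    (hd : (P.natDegree + 3) * θ < Real.pi) :
    P.signVariations + 2 ≤
      ((X ^ 2 - C (2 * (r * Real.cos θ)) * X + C (r ^ 2)) * P).signVariations := by
  have hdeg : (P.comp (C r * X)).natDegree = P.natDegree := by
    rw [natDegree_comp, natDegree_C_mul_X _ hr.ne', mul_one]
  have hne : P.comp (C r * X) ≠ 0 := by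
    refine ne_zero_of_sign_coeff (Q := P) (fun i => ?_) hP
    rw [comp_C_mul_X_coeff, sign_mul, sign_pos (pow_pos hr i), mul_one]
  have h := signVariations_add_two_le_unit hne hθ (by rwa [hdeg])
  rw [signVariations_comp_C_mul_X P hr] at h
  have e : ((X ^ 2 - C (2 * (r * Real.cos θ)) * X + C (r ^ 2)) * P).comp (C r * X) =
      C (r ^ 2) * ((X ^ 2 - C (2 * Real.cos θ) * X + C 1) * P.comp (C r * X)) := by
    simp only [mul_comp, add_comp, sub_comp, C_comp, X_comp, pow_comp, C_mul, C_pow, C_1]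
    ring
  rw [← signVariations_comp_C_mul_X (_ * P) hr, e, signVariations_C_mul _ (by positivity)]
  exact h

/-- The open sector of the nonzero complex numbers `x` with `(n + 1) |arg x| < π`. -/
def InSector (n : ℕ) (x : ℂ) : Prop := x ≠ 0 ∧ (n + 1) * |x.arg| < Real.pi

/-- `|arg x| ≤ tan |arg x| = |im x| / re x ≤ 1 / (n + 1)`, and `1 < π`. -/
theorem inSector_of_im_le {n : ℕ} {x : ℂ} (hre : 0 < x.re) (him : (n + 1) * |x.im| ≤ x.re) :
    InSector n x := by
  refine ⟨by rintro rfl; simp at hre, ?_⟩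
  have h1 : |x.arg| < Real.pi / 2 := Complex.abs_arg_lt_pi_div_two_iff.2 (Or.inl hre)
  have h2 := Real.le_tan (abs_nonneg _) h1
  have h3 : Real.tan |x.arg| = |x.im| / x.re := by
    rcases abs_cases x.arg with ⟨h, h'⟩ | ⟨h, h'⟩
    · rw [h, Complex.tan_arg, abs_of_nonneg (Complex.arg_nonneg_iff.1 h')]
    · rw [h, Real.tan_neg, Complex.tan_arg, abs_of_neg (Complex.arg_neg_iff.1 h'), neg_div]
  rw [h3, le_div_iff₀ hre] at h2
  have h4 : (n + 1) * |x.arg| ≤ 1 := by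
    by_contra hcon
    push Not at hcon
    have : x.re < (n + 1) * |x.arg| * x.re := by nlinarith
    nlinarith
  linarith [Real.pi_gt_three]

open Classical in
/-- Lower bound of Obreshkoff type: the roots in a narrow sector around the positive real axis are
counted by the sign variations. -/
theorem countP_inSector_le {n : ℕ} (P : ℝ[X]) (hP : P ≠ 0) (hn : P.natDegree ≤ n) :
    (P.map (algebraMap ℝ ℂ)).roots.countP (InSector n) ≤ P.signVariations := by
  induction hd : P.natDegree using Nat.strong_induction_on generalizing P with
  | _ d ih =>
  subst hd
  have hPc : P.map (algebraMap ℝ ℂ) ≠ 0 :=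
    (Polynomial.map_ne_zero_iff (algebraMap ℝ ℂ).injective).2 hP
  by_cases hex : ∃ x ∈ (P.map (algebraMap ℝ ℂ)).roots, InSector n x
  swap
  · push Not at hex
    rw [Multiset.countP_eq_zero.2 hex]
    exact Nat.zero_le _
  obtain ⟨x, hx, hx0, hxs⟩ := hex
  have hroot : aeval x P = 0 := by
    rw [mem_roots hPc, IsRoot.def, eval_map_algebraMap] at hx
    exact hx
  by_cases him : x.im = 0
  · have hxre : x = (x.re : ℂ) := by apply Complex.ext <;> simp [him]
    have hpos : 0 < x.re := by
      rcases lt_trichotomy x.re 0 with h | h | h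
      · exfalso
        rw [hxre, Complex.arg_ofReal_of_neg h, abs_of_pos Real.pi_pos] at hxs
        nlinarith [Real.pi_pos, (Nat.cast_nonneg n : (0 : ℝ) ≤ n)]
      · exact absurd (by rw [hxre, h]; simp) hx0
      · exact h
    have hr : P.IsRoot x.re := by
      rw [hxre] at hroot
      rw [IsRoot.def]
      have := Polynomial.aeval_algebraMap_apply ℂ x.re P
      simp only [Complex.coe_algebraMap, hroot, Polynomial.aeval_def,
        Algebra.algebraMap_self, eval₂_id] at this
      exact_mod_cast this.symm
    obtain ⟨Q, rfl⟩ := dvd_iff_isRoot.2 hr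
    have hQ : Q ≠ 0 := right_ne_zero_of_mul hP
    have hdeg : ((X - C x.re) * Q).natDegree = Q.natDegree + 1 := by
      rw [natDegree_mul (X_sub_C_ne_zero _) hQ, natDegree_X_sub_C, add_comm]
    have h1 := ih Q.natDegree (by omega) Q hQ (by omega) rfl
    have h2 := succ_signVariations_le_X_sub_C_mul hpos hQ
    rw [Polynomial.map_mul] at hPc ⊢
    rw [roots_mul hPc, Multiset.countP_add]
    have h3 : ((X - C x.re : ℝ[X]).map (algebraMap ℝ ℂ)).roots.countP (InSector n) ≤ 1 := by
      refine (Multiset.countP_le_card _ _).trans ((card_roots' _).trans ?_)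
      exact natDegree_map_le.trans (natDegree_X_sub_C _).le
    omega
  · obtain ⟨Q, rfl⟩ := quadratic_dvd_of_aeval_eq_zero_im_ne_zero P hroot him
    have hQ : Q ≠ 0 := right_ne_zero_of_mul hP
    set q := (X ^ 2 - C (2 * x.re) * X + C (‖x‖ ^ 2) : ℝ[X]) with hq
    have hq0 : q ≠ 0 := left_ne_zero_of_mul hP
    have hqd : q.natDegree = 2 := by rw [hq]; compute_degree!
    have hdeg : (q * Q).natDegree = Q.natDegree + 2 := by
      rw [natDegree_mul hq0 hQ, hqd, add_comm]
    have h1 := ih Q.natDegree (by omega) Q hQ (by omega) rfl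
    have harg : 0 < |x.arg| := by
      rw [abs_pos]
      intro h
      exact him (Complex.arg_eq_zero_iff.1 h).2
    have h2 := signVariations_add_two_le hQ harg (norm_pos_iff.2 hx0)
      (lt_of_le_of_lt (by
        -- Removing a conjugate pair lowers the degree by two, so `deg Q + 3 ≤ n + 1` and the sector
        -- condition suffices.
        refine mul_le_mul_of_nonneg_right ?_ harg.le
        have : Q.natDegree + 2 ≤ n := by omega
        have : (Q.natDegree : ℝ) + 2 ≤ n := by exact_mod_cast this
        linarith) hxs)
    rw [Real.cos_abs, Complex.norm_mul_cos_arg, ← hq] at h2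
    rw [Polynomial.map_mul] at hPc ⊢
    rw [roots_mul hPc, Multiset.countP_add]
    have h3 : (q.map (algebraMap ℝ ℂ)).roots.countP (InSector n) ≤ 2 := by
      refine (Multiset.countP_le_card _ _).trans ((card_roots' _).trans ?_)
      exact natDegree_map_le.trans hqd.le
    omega

theorem eraseLead_comp_neg_X (P : ℝ[X]) : (P.comp (-X)).eraseLead = P.eraseLead.comp (-X) := by
  have hc : ∀ (Q : ℝ[X]) (i : ℕ), (Q.comp (-X)).coeff i = (-1) ^ i * Q.coeff i := by
    intro Q i
    rw [show (-X : ℝ[X]) = C (-1) * X by simp, comp_C_mul_X_coeff, mul_comm]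
  have hd : (P.comp (-X)).natDegree = P.natDegree := by
    rw [natDegree_comp, natDegree_neg, natDegree_X, mul_one]
  ext i
  rw [eraseLead_coeff, hc, hc, eraseLead_coeff, hd]
  split_ifs <;> simp

/-- Removing the leading term lowers each count by at most one. If the degree drops by exactly one,
the two leading terms change sign in only one of `P(x)` and `P(-x)`. -/
theorem signVariations_add_comp_neg_X_le (P : ℝ[X]) :
    P.signVariations + (P.comp (-X)).signVariations ≤ P.natDegree := by
  induction hd : P.natDegree using Nat.strong_induction_on generalizing P with
  | _ d ih =>
  subst hd
  by_cases hP : P = 0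
  · simp [hP]
  have hP' : P.comp (-X) ≠ 0 := by rwa [Ne, comp_neg_X_eq_zero_iff]
  have e1 := signVariations_eq_eraseLead_add_ite hP
  have e2 := signVariations_eq_eraseLead_add_ite hP'
  rw [eraseLead_comp_neg_X, comp_neg_X_leadingCoeff_eq, comp_neg_X_leadingCoeff_eq] at e2
  by_cases hE : P.eraseLead = 0
  · simp [hE, hP] at e1 e2
    omega
  have hlt : P.eraseLead.natDegree < P.natDegree := by
    rcases P.eraseLead_natDegree_lt_or_eraseLead_eq_zero with h | h
    · exact h
    · exact absurd h hE
  have h := ih _ hlt P.eraseLead rfl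
  by_cases h2 : P.eraseLead.natDegree + 2 ≤ P.natDegree
  · split_ifs at e1 e2 <;> omega
  have h1 : P.natDegree = P.eraseLead.natDegree + 1 := by omega
  have hl1 : SignType.sign P.leadingCoeff ≠ 0 := by simpa using hP
  have hl2 : SignType.sign P.eraseLead.leadingCoeff ≠ 0 := by simpa using hE
  have hnot : ¬ (SignType.sign P.leadingCoeff = -SignType.sign P.eraseLead.leadingCoeff ∧
      SignType.sign ((-1) ^ P.natDegree * P.leadingCoeff) =
      -SignType.sign ((-1) ^ P.eraseLead.natDegree * P.eraseLead.leadingCoeff)) := by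
    rintro ⟨g1, g2⟩
    rw [h1, pow_succ, sign_mul, sign_mul, sign_mul, g1] at g2
    rcases neg_one_pow_eq_or ℝ P.eraseLead.natDegree with hp | hp <;> rw [hp] at g2 <;>
    · generalize SignType.sign P.eraseLead.leadingCoeff = σ at *
      revert g2 hl2
      simp
  split_ifs at e1 e2 <;> first | omega | (exfalso; exact hnot ⟨by assumption, by assumption⟩)

open Classical in
/-- Upper bound of Obreshkoff type: there are at least as many roots outside a narrow sector around
the negative real axis as there are sign variations. -/
theorem signVariations_le_countP {n : ℕ} (P : ℝ[X]) (hP : P ≠ 0) (hn : P.natDegree ≤ n) :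
    P.signVariations ≤ (P.map (algebraMap ℝ ℂ)).roots.countP (fun x => ¬ InSector n (-x)) := by
  have hP' : P.comp (-X) ≠ 0 := by rwa [Ne, comp_neg_X_eq_zero_iff]
  have hd : (P.comp (-X)).natDegree = P.natDegree := by
    rw [natDegree_comp, natDegree_neg, natDegree_X, mul_one]
  -- The lower bound applied to `P(-x)` counts the roots near the negative axis; subtracting from
  -- the degree gives the upper bound for `P`.
  have h1 := countP_inSector_le (n := n) (P.comp (-X)) hP' (by omega)
  have h2 := signVariations_add_comp_neg_X_le P
  have e : (P.comp (-X)).map (algebraMap ℝ ℂ) = (P.map (algebraMap ℝ ℂ)).comp (-X) := by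
    rw [Polynomial.map_comp]; simp
  rw [e, roots_comp_neg_X, Multiset.countP_map, ← Multiset.countP_eq_card_filter] at h1
  have h3 : P.natDegree = (P.map (algebraMap ℝ ℂ)).roots.card := by
    rw [← (IsAlgClosed.splits _).natDegree_eq_card_roots, natDegree_map]
  have h4 := Multiset.card_eq_countP_add_countP (fun x => InSector n (-x))
    (P.map (algebraMap ℝ ℂ)).roots
  omega

/-! ### Roots of `f` near an interval and its sign variations. -/

/-- The multiset of complex roots of a real polynomial. -/
def croots (f : ℝ[X]) : Multiset ℂ := (f.map (algebraMap ℝ ℂ)).roots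

theorem card_croots (f : ℝ[X]) : (croots f).card = f.natDegree := by
  rw [croots, ← (IsAlgClosed.splits _).natDegree_eq_card_roots, natDegree_map]

theorem map_eq_prod_croots (f : ℝ[X]) : f.map (algebraMap ℝ ℂ) =
    C (f.leadingCoeff : ℂ) * ((croots f).map (fun z => X - C z)).prod := by
  have := (IsAlgClosed.splits (f.map (algebraMap ℝ ℂ))).eq_prod_roots
  rw [leadingCoeff_map] at this
  exact this

theorem map_mobius (f : ℝ[X]) (a b : ℝ) : (mobius f a b).map (algebraMap ℝ ℂ) =
    C (f.leadingCoeff : ℂ) *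
      ((croots f).map (fun z => C ((a : ℂ) - z) * X + C ((b : ℂ) - z))).prod := by
  apply Polynomial.eq_of_infinite_eval_eq
  have hinf : ({-1}ᶜ : Set ℂ).Infinite := (Set.finite_singleton _).infinite_compl
  apply hinf.mono
  intro y hy
  have hy : y + 1 ≠ 0 := fun h => hy (eq_neg_of_add_eq_zero_left h)
  simp only [Set.mem_ofPred_eq]
  have h1 : ((mobius f a b).map (algebraMap ℝ ℂ)).eval y =
      (y + 1) ^ f.natDegree * (f.map (algebraMap ℝ ℂ)).eval ((a * y + b) / (y + 1)) := by
    rw [eval_eq_sum_range (p := f.map _), natDegree_map, Finset.mul_sum, mobius,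
      Polynomial.map_sum, eval_finsetSum]
    apply Finset.sum_congr rfl
    intro i hi
    have hi : i ≤ f.natDegree := by simpa [Nat.lt_succ_iff] using hi
    simp only [Polynomial.map_mul, Polynomial.map_pow, Polynomial.map_add, map_C, map_X,
      Polynomial.map_one, eval_mul, eval_pow, eval_add, eval_C, eval_X, eval_one, coeff_map,
      Complex.coe_algebraMap]
    rw [pow_sub₀ _ hy hi, div_pow]
    field_simp
  rw [h1, map_eq_prod_croots f, eval_mul, eval_C, eval_mul, eval_C, eval_multiset_prod,
    eval_multiset_prod, ← card_croots, mul_left_comm]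
  congr 1
  rw [Multiset.map_map, Multiset.map_map, ← Multiset.prod_replicate, ← Multiset.map_const',
    ← Multiset.prod_map_mul]
  congr 1
  apply Multiset.map_congr rfl
  intro z _
  simp only [Function.comp, eval_sub, eval_X, eval_C, eval_add, eval_mul]
  field_simp
  ring

theorem mobius_ne_zero {f : ℝ[X]} (hf : f ≠ 0) {a b : ℝ} (hab : a < b) : mobius f a b ≠ 0 := by
  intro h
  have := map_mobius f a b
  rw [h, Polynomial.map_zero, eq_comm, mul_eq_zero, Multiset.prod_eq_zero_iff,
    Multiset.mem_map] at this
  rcases this with h | ⟨z, -, hz⟩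
  · simp [hf] at h
  · have h1 := congrArg (eval 0) hz
    have h2 := congrArg (eval 1) hz
    simp at h1 h2
    have : (a : ℂ) = b := by linear_combination h2 - 2 * h1
    exact hab.ne (by exact_mod_cast this)

-- A root at `a` turns its linear factor into a constant: it moves to infinity and leaves the root
-- multiset.
open Classical in
theorem roots_mobius {f : ℝ[X]} (hf : f ≠ 0) {a b : ℝ} (hab : a < b) :
    ((mobius f a b).map (algebraMap ℝ ℂ)).roots =
      ((croots f).filter (fun z : ℂ => z ≠ a)).map (fun z => ((b : ℂ) - z) / (z - a)) := by
  have hba : (b : ℂ) - a ≠ 0 := by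
    rw [sub_ne_zero]; exact_mod_cast hab.ne'
  rw [map_mobius, roots_C_mul _ (by simpa using hf), roots_multiset_prod]
  · rw [Multiset.bind_map]
    have : ∀ s : Multiset ℂ, s.bind (fun z => (C ((a : ℂ) - z) * X + C ((b : ℂ) - z)).roots) =
        (s.filter (fun z : ℂ => z ≠ a)).map (fun z => ((b : ℂ) - z) / (z - a)) := by
      intro s
      induction s using Multiset.induction_on with
      | empty => simp
      | cons z s ih =>
        rw [Multiset.cons_bind, ih]
        by_cases hz : z = a
        · rw [hz, Multiset.filter_cons_of_neg _ (by simp), sub_self, C_0, zero_mul, zero_add,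
            roots_C, zero_add]
        · have hz' : (a : ℂ) - z ≠ 0 := sub_ne_zero.2 (Ne.symm hz)
          have hz'' : z - (a : ℂ) ≠ 0 := sub_ne_zero.2 hz
          rw [Multiset.filter_cons_of_pos (p := fun z : ℂ => z ≠ a) _ hz,
            Multiset.map_cons, roots_C_mul_X_add_C _ hz',
            ← Multiset.singleton_add]
          congr 2
          rw [← neg_sub z (a : ℂ)]
          field_simp
    exact this _
  · rw [Multiset.mem_map]
    rintro ⟨z, -, hz⟩
    have h1 := congrArg (eval 0) hz
    have h2 := congrArg (eval 1) hz
    simp at h1 h2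
    exact hba (by linear_combination 2 * h1 - h2)

/-- A rhombus over `(a, b)` whose angles at `a` and `b` are of order `1 / n`. -/
def InLens (n : ℕ) (a b : ℝ) (z : ℂ) : Prop :=
  a < z.re ∧ z.re < b ∧ 4 * (n + 1) * |z.im| ≤ z.re - a ∧ 4 * (n + 1) * |z.im| ≤ b - z.re

/-- Up to sign, the argument of the image is the sum of the angles under which `z` is seen at `a`
and `b`, and their tangents are at most `1 / (4 (n + 1))`. -/
theorem inSector_of_inLens {n : ℕ} {a b : ℝ} {z : ℂ} (h : InLens n a b z) :
    InSector n (((b : ℂ) - z) / (z - a)) := by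
  obtain ⟨h1, h2, h3, h4⟩ := h
  have hza : z - a ≠ 0 := by
    intro h
    have := congrArg Complex.re h
    simp at this
    linarith
  have hpos : 0 < Complex.normSq (z - a) := Complex.normSq_pos.2 hza
  have e : ((b : ℂ) - z) / (z - a) =
      ((Complex.normSq (z - a))⁻¹ : ℝ) * (((b : ℂ) - z) * (starRingEnd ℂ) (z - a)) := by
    rw [div_eq_mul_inv, Complex.inv_def]
    push_cast
    ring
  set s := z.re - a with hs
  set u := b - z.re with hu
  set M : ℝ := n + 1 with hM
  have hM1 : 1 ≤ M := by simp [hM]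
  have hs0 : 0 < s := by linarith
  have hu0 : 0 < u := by linarith
  have hh : 0 ≤ |z.im| := abs_nonneg _
  have hsq : |z.im| ^ 2 = z.im ^ 2 := sq_abs _
  have k1 : 16 * z.im ^ 2 ≤ s * u := by
    have e1 : 4 * |z.im| ≤ s := by nlinarith
    have e2 : 4 * |z.im| ≤ u := by nlinarith
    calc 16 * z.im ^ 2 = (4 * |z.im|) * (4 * |z.im|) := by rw [← hsq]; ring
      _ ≤ s * u := by gcongr
  have k2 : M * (|z.im| * (s + u)) * 4 ≤ 2 * (s * u) := by nlinarith
  have hre : (((b : ℂ) - z) * (starRingEnd ℂ) (z - a)).re = s * u - z.im ^ 2 := by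
    simp [hs, hu]; ring
  have him : (((b : ℂ) - z) * (starRingEnd ℂ) (z - a)).im = -(z.im * (s + u)) := by
    simp [hs, hu]; ring
  have hsu : 0 < s * u := mul_pos hs0 hu0
  apply inSector_of_im_le
  · rw [e, Complex.re_ofReal_mul, hre]
    apply mul_pos (inv_pos.2 hpos)
    linarith
  · rw [e, Complex.re_ofReal_mul, Complex.im_ofReal_mul, hre, him, abs_mul, abs_neg, abs_mul,
      abs_of_pos (inv_pos.2 hpos), abs_of_pos (add_pos hs0 hu0), mul_left_comm]
    refine mul_le_mul_of_nonneg_left ?_ (inv_pos.2 hpos).le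
    linarith

theorem countP_mono {α : Type*} (s : Multiset α) {p q : α → Prop} [DecidablePred p]
    [DecidablePred q] (h : ∀ x, p x → q x) : s.countP p ≤ s.countP q := by
  rw [Multiset.countP_eq_card_filter, Multiset.countP_eq_card_filter]
  exact Multiset.card_le_card (Multiset.monotone_filter_right s h)

open Classical in
/-- The number of roots in the rhombus over `(a, b)` is bounded by the sign variations. -/
theorem countP_inLens_le_var {f : ℝ[X]} (hf : f ≠ 0) {a b : ℝ} (hab : a < b) :
    (croots f).countP (InLens f.natDegree a b) ≤ var f a b := by
  have h := countP_inSector_le (n := f.natDegree) _ (mobius_ne_zero hf hab)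
    (natDegree_mobius_le f a b)
  rw [roots_mobius hf hab, Multiset.countP_map, ← Multiset.countP_eq_card_filter,
    Multiset.countP_filter] at h
  refine le_trans (countP_mono _ ?_) h
  intro z hz
  refine ⟨inSector_of_inLens hz, ?_⟩
  rintro rfl
  simpa using hz.1

/-- The number in question is `1 - (b - a) / (z - a)`, which differs from 1 by at most `1 / (2 (n +
1))`. -/
theorem inSector_of_norm_ge {n : ℕ} {a b : ℝ} (hab : a < b) {z : ℂ}
    (h : 2 * (n + 1) * (b - a) ≤ ‖z - a‖) : InSector n (-(((b : ℂ) - z) / (z - a))) := by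
  have hw : 0 < b - a := by linarith
  have hpos : 0 < ‖z - a‖ := lt_of_lt_of_le (by positivity) h
  have hza : z - a ≠ 0 := norm_pos_iff.1 hpos
  set e : ℂ := ((b - a : ℝ) : ℂ) / (z - a) with he
  have hx : -(((b : ℂ) - z) / (z - a)) = 1 - e := by
    rw [he]
    push_cast
    field_simp
    ring
  have hn : (n + 1) * ‖e‖ ≤ 1 / 2 := by
    rw [he, norm_div, Complex.norm_real, Real.norm_of_nonneg hw.le, ← mul_div_assoc,
      div_le_iff₀ hpos]
    linarith
  have hn' : ‖e‖ ≤ 1 / 2 := by nlinarith [norm_nonneg e, (Nat.cast_nonneg n : (0 : ℝ) ≤ n)]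
  have hre := Complex.abs_re_le_norm e
  have him := Complex.abs_im_le_norm e
  have hre' := (abs_le.1 hre).2
  rw [hx]
  apply inSector_of_im_le
  · simp only [Complex.sub_re, Complex.one_re]
    linarith
  · simp only [Complex.sub_re, Complex.one_re, Complex.sub_im, Complex.one_im, zero_sub, abs_neg]
    calc (n + 1) * |e.im| ≤ (n + 1) * ‖e‖ := by gcongr
      _ ≤ 1 - e.re := by linarith

open Classical in
/-- There are at least as many roots close to `(a, b)` as there are sign variations. -/
theorem var_le_countP {f : ℝ[X]} (hf : f ≠ 0) {a b : ℝ} (hab : a < b) :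
    var f a b ≤ (croots f).countP (fun z : ℂ => ‖z - a‖ < 2 * (f.natDegree + 1) * (b - a)) := by
  have h := signVariations_le_countP (n := f.natDegree) _ (mobius_ne_zero hf hab)
    (natDegree_mobius_le f a b)
  rw [roots_mobius hf hab, Multiset.countP_map, ← Multiset.countP_eq_card_filter,
    Multiset.countP_filter] at h
  refine le_trans h (countP_mono _ ?_)
  rintro z ⟨hz, -⟩
  by_contra hcon
  exact hz (inSector_of_norm_ge hab (not_lt.1 hcon))

/-! ### Root separation for integer polynomials. -/

theorem map_algebraMap_map_int (f : ℤ[X]) :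
    (f.map (Int.castRingHom ℝ)).map (algebraMap ℝ ℂ) = f.map (Int.castRingHom ℂ) := by
  rw [Polynomial.map_map]
  congr 1

theorem croots_nodup {f : ℤ[X]} (hf : Squarefree (f.map (Int.castRingHom ℚ))) :
    (croots (f.map (Int.castRingHom ℝ))).Nodup := by
  have hs : (f.map (Int.castRingHom ℚ)).Separable := PerfectField.separable_iff_squarefree.2 hf
  have h2 := nodup_roots (hs.map (f := algebraMap ℚ ℂ))
  rw [Polynomial.map_map] at h2
  rw [croots, map_algebraMap_map_int]
  rwa [RingHom.ext_int (Int.castRingHom ℂ) ((algebraMap ℚ ℂ).comp (Int.castRingHom ℚ))]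

/-- The expression is the resultant of `f` and `f'`: an integer, and nonzero because square-free
means separable in characteristic zero. -/
theorem one_le_norm_prod_derivative {f : ℤ[X]} (hf : Squarefree (f.map (Int.castRingHom ℚ))) :
    1 ≤ ‖((f.leadingCoeff : ℂ) ^ f.derivative.natDegree *
      ((croots (f.map (Int.castRingHom ℝ))).map
        (fun z => (f.derivative.map (Int.castRingHom ℂ)).eval z)).prod)‖ := by
  have hs : (f.map (Int.castRingHom ℚ)).Separable := PerfectField.separable_iff_squarefree.2 hf
  have h1 := resultant_ne_zero _ _ hs
  have hq : Function.Injective (Int.castRingHom ℚ) := Int.cast_injective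
  have hc : Function.Injective (Int.castRingHom ℂ) := Int.cast_injective
  rw [derivative_map, natDegree_map_eq_of_injective hq, natDegree_map_eq_of_injective hq,
    resultant_map_map] at h1
  have h2 : f.resultant f.derivative ≠ 0 := by
    intro h
    rw [h] at h1
    simp at h1
  have h3 := resultant_eq_prod_eval (f.map (Int.castRingHom ℂ))
    (f.derivative.map (Int.castRingHom ℂ)) f.derivative.natDegree natDegree_map_le
    (IsAlgClosed.splits _)
  rw [natDegree_map_eq_of_injective hc, resultant_map_map,
    leadingCoeff_map_of_injective hc] at h3
  rw [croots, map_algebraMap_map_int]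
  simp only [eq_intCast] at h3
  rw [← h3, Complex.norm_intCast]
  exact_mod_cast Int.one_le_abs h2

/-- Cauchy's bound; integrality gives coefficients of size at most `2 ^ τ - 1`, which absorbs the
summand 1. -/
theorem norm_croot_le {f : ℤ[X]} {τ : ℕ} (hτ : ∀ i, |f.coeff i| < 2 ^ τ) {z : ℂ}
    (hz : z ∈ croots (f.map (Int.castRingHom ℝ))) : ‖z‖ ≤ 2 ^ τ := by
  have hc : Function.Injective (Int.castRingHom ℂ) := Int.cast_injective
  rw [croots, map_algebraMap_map_int] at hz
  have hne : f.map (Int.castRingHom ℂ) ≠ 0 := (mem_roots'.1 hz).1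
  have hf : f ≠ 0 := by rintro rfl; simp at hne
  have h := IsRoot.norm_lt_cauchyBound hne (mem_roots'.1 hz).2
  have h' : ‖z‖ < ((f.map (Int.castRingHom ℂ)).cauchyBound : ℝ) := by exact_mod_cast h
  refine h'.le.trans ?_
  rw [cauchyBound, leadingCoeff_map_of_injective hc]
  have hl : (1 : ℝ) ≤ ‖(Int.castRingHom ℂ) f.leadingCoeff‖ := by
    rw [eq_intCast, Complex.norm_intCast]
    exact_mod_cast Int.one_le_abs (leadingCoeff_ne_zero.2 hf)
  have hsup : ((Finset.range (f.map (Int.castRingHom ℂ)).natDegree).sup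
      fun x => ‖(f.map (Int.castRingHom ℂ)).coeff x‖₊) ≤ (2 ^ τ - 1 : ℕ) := by
    apply Finset.sup_le
    intro i _
    rw [← NNReal.coe_le_coe, coe_nnnorm, coeff_map, eq_intCast, Complex.norm_intCast]
    have h1 : |f.coeff i| ≤ 2 ^ τ - 1 := Int.le_sub_one_of_lt (hτ i)
    have h2 : ((2 ^ τ - 1 : ℕ) : ℤ) = 2 ^ τ - 1 := by
      rw [Nat.cast_sub Nat.one_le_two_pow]; simp
    rw [← h2] at h1
    rw [NNReal.coe_natCast, ← Int.cast_abs]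
    have h3 : ((|f.coeff i| : ℤ) : ℝ) ≤ (((2 ^ τ - 1 : ℕ) : ℤ) : ℝ) := Int.cast_le.2 h1
    rwa [Int.cast_natCast] at h3
  rw [← NNReal.coe_le_coe, NNReal.coe_natCast, Nat.cast_sub Nat.one_le_two_pow] at hsup
  push_cast at hsup ⊢
  have h4 := div_le_self (NNReal.coe_nonneg
    ((Finset.range (f.map (Int.castRingHom ℂ)).natDegree).sup fun x => ‖(f.map (Int.castRingHom ℂ)).coeff x‖₊)) hl
  linarith

theorem eval_derivative_croot (f : ℤ[X]) {z : ℂ} (hz : z ∈ croots (f.map (Int.castRingHom ℝ))) :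
    (f.derivative.map (Int.castRingHom ℂ)).eval z = f.leadingCoeff *
      (((croots (f.map (Int.castRingHom ℝ))).erase z).map (fun y => z - y)).prod := by
  have h := map_eq_prod_croots (f.map (Int.castRingHom ℝ))
  rw [map_algebraMap_map_int] at h
  rw [← derivative_map, h, derivative_C_mul, eval_mul, eval_C,
    eval_multiset_prod_X_sub_C_derivative hz,
    leadingCoeff_map_of_injective (Int.cast_injective (α := ℝ))]
  simp

theorem prod_norm_le {s : Multiset ℂ} {B : ℝ} (hB : 0 ≤ B) (h : ∀ z ∈ s, ‖z‖ ≤ B) :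
    ‖s.prod‖ ≤ B ^ s.card := by
  induction s using Multiset.induction_on with
  | empty => simp
  | cons a s ih =>
    rw [Multiset.prod_cons, norm_mul, Multiset.card_cons, pow_succ']
    exact mul_le_mul (h a (Multiset.mem_cons_self a s))
      (ih fun z hz => h z (Multiset.mem_cons_of_mem hz)) (norm_nonneg _) hB

/-- Root separation. -/
theorem separation {f : ℤ[X]} (hf : Squarefree (f.map (Int.castRingHom ℚ))) {τ : ℕ} (hτ1 : 1 ≤ τ)
    (hτ : ∀ i, |f.coeff i| < 2 ^ τ) {z z' : ℂ} (hz : z ∈ croots (f.map (Int.castRingHom ℝ)))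
    (hz' : z' ∈ croots (f.map (Int.castRingHom ℝ))) (hne : z' ≠ z) :
    1 ≤ 2 ^ (4 * τ * f.natDegree ^ 2) * ‖z - z'‖ := by
  set s := croots (f.map (Int.castRingHom ℝ)) with hs
  have hcard : s.card = f.natDegree := by
    rw [hs, card_croots, natDegree_map_eq_of_injective (Int.cast_injective (α := ℝ))]
  set n := f.natDegree with hn
  have hn1 : 2 ≤ n := by
    have h1 : z' ∈ s.erase z := (Multiset.mem_erase_of_ne hne).2 hz'
    have h2 := Multiset.card_pos_iff_exists_mem.2 ⟨_, h1⟩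
    rw [Multiset.card_erase_of_mem hz, Nat.pred_eq_sub_one] at h2
    rw [← hcard]
    omega
  have hl : ‖(f.leadingCoeff : ℂ)‖ ≤ 2 ^ τ := by
    rw [Complex.norm_intCast]
    exact_mod_cast (hτ f.natDegree).le
  have hdist : ∀ x ∈ s, ∀ y ∈ s, ‖x - y‖ ≤ 2 ^ (τ + 1) := by
    intro x hx y hy
    have := norm_sub_le x y
    have h1 := norm_croot_le hτ hx
    have h2 := norm_croot_le hτ hy
    rw [pow_succ]
    linarith
  have hB1 : (1 : ℝ) ≤ 2 ^ (τ + 1) := one_le_pow₀ (by norm_num)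
  have hder : ∀ x ∈ s, ‖(f.derivative.map (Int.castRingHom ℂ)).eval x‖
      ≤ 2 ^ τ * (2 ^ (τ + 1)) ^ (n - 1) := by
    intro x hx
    rw [eval_derivative_croot f hx, norm_mul]
    refine mul_le_mul hl ?_ (norm_nonneg _) (by positivity)
    refine (prod_norm_le (B := 2 ^ (τ + 1)) (by positivity) ?_).trans_eq ?_
    · intro y hy
      obtain ⟨t, ht, rfl⟩ := Multiset.mem_map.1 hy
      exact hdist _ hx _ (Multiset.mem_of_mem_erase ht)
    · rw [Multiset.card_map, Multiset.card_erase_of_mem hx, hcard]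
      rfl
  -- The factor `z - z'` of `f'(z)` is kept while everything else in the resultant is bounded above;
  -- as the resultant has norm at least 1, this bounds `‖z - z'‖` below.
  have hderz : ‖(f.derivative.map (Int.castRingHom ℂ)).eval z‖
      ≤ 2 ^ τ * ((2 ^ (τ + 1)) ^ (n - 1) * ‖z - z'‖) := by
    have h1 : z' ∈ s.erase z := (Multiset.mem_erase_of_ne hne).2 hz'
    rw [eval_derivative_croot f hz, norm_mul]
    refine mul_le_mul hl ?_ (norm_nonneg _) (by positivity)
    rw [← hs, ← Multiset.cons_erase h1, Multiset.map_cons, Multiset.prod_cons, norm_mul, mul_comm]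
    refine mul_le_mul_of_nonneg_right ?_ (norm_nonneg _)
    refine (prod_norm_le (B := 2 ^ (τ + 1)) (by positivity) ?_).trans ?_
    · intro y hy
      obtain ⟨t, ht, rfl⟩ := Multiset.mem_map.1 hy
      exact hdist _ hz _ (Multiset.mem_of_mem_erase (Multiset.mem_of_mem_erase ht))
    · apply pow_le_pow_right₀ hB1
      rw [Multiset.card_map, Multiset.card_erase_of_mem h1, Multiset.card_erase_of_mem hz, hcard]
      exact Nat.pred_le _
  have h1 := one_le_norm_prod_derivative hf
  rw [← hs, ← Multiset.cons_erase hz, Multiset.map_cons, Multiset.prod_cons, norm_mul, norm_mul,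
    norm_pow] at h1
  have h2 : ‖((s.erase z).map (fun z => (f.derivative.map (Int.castRingHom ℂ)).eval z)).prod‖
      ≤ (2 ^ τ * (2 ^ (τ + 1)) ^ (n - 1)) ^ (n - 1) := by
    refine (prod_norm_le (B := 2 ^ τ * (2 ^ (τ + 1)) ^ (n - 1)) (by positivity) ?_).trans_eq ?_
    · intro y hy
      obtain ⟨t, ht, rfl⟩ := Multiset.mem_map.1 hy
      exact hder _ (Multiset.mem_of_mem_erase ht)
    · rw [Multiset.card_map, Multiset.card_erase_of_mem hz, hcard]
      rfl
  have h3 : ‖(f.leadingCoeff : ℂ)‖ ^ f.derivative.natDegree ≤ (2 ^ τ) ^ (n - 1) := by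
    refine (pow_le_pow_left₀ (norm_nonneg _) hl _).trans ?_
    exact pow_le_pow_right₀ (one_le_pow₀ (by norm_num)) (natDegree_derivative_le f)
  have h4 : 1 ≤ (2 ^ τ) ^ (n - 1) * ((2 ^ τ * ((2 ^ (τ + 1)) ^ (n - 1) * ‖z - z'‖)) *
      (2 ^ τ * (2 ^ (τ + 1)) ^ (n - 1)) ^ (n - 1)) := by
    refine h1.trans ?_
    gcongr
  refine h4.trans ?_
  have e : (2 ^ τ : ℝ) ^ (n - 1) * ((2 ^ τ * ((2 ^ (τ + 1)) ^ (n - 1) * ‖z - z'‖)) *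
      (2 ^ τ * (2 ^ (τ + 1)) ^ (n - 1)) ^ (n - 1)) =
      2 ^ (τ * (n - 1) + τ + (τ + 1) * (n - 1) + (τ + (τ + 1) * (n - 1)) * (n - 1)) * ‖z - z'‖ := by
    simp only [pow_add, pow_mul, mul_pow]
    ring
  rw [e]
  refine mul_le_mul_of_nonneg_right ?_ (norm_nonneg _)
  apply pow_le_pow_right₀ (by norm_num)
  obtain ⟨m, hm⟩ : ∃ m, n = m + 1 := ⟨n - 1, by omega⟩
  rw [hm, Nat.add_sub_cancel]
  nlinarith [Nat.zero_le m, Nat.zero_le τ, Nat.mul_le_mul_right m hτ1,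
    Nat.mul_le_mul_right (m * m) hτ1]

/-- An interval with at least two sign variations is not too small. -/
theorem one_le_width_of_two_le_var {f : ℤ[X]} (hf : Squarefree (f.map (Int.castRingHom ℚ))) {τ : ℕ}
    (hτ1 : 1 ≤ τ) (hτ : ∀ i, |f.coeff i| < 2 ^ τ) {a b : ℝ} (hab : a < b)
    (hv : 2 ≤ var (f.map (Int.castRingHom ℝ)) a b) :
    1 ≤ 2 ^ (8 * τ * f.natDegree ^ 2) * (b - a) := by
  classical
  have hinj : Function.Injective (Int.castRingHom ℝ) := Int.cast_injective
  have hf0 : f.map (Int.castRingHom ℝ) ≠ 0 := by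
    intro h
    rw [Polynomial.map_eq_zero_iff hinj] at h
    rw [h, Polynomial.map_zero] at hf
    exact not_squarefree_zero hf
  have h := hv.trans (var_le_countP hf0 hab)
  rw [natDegree_map_eq_of_injective hinj] at h
  set n := f.natDegree with hn
  rw [Multiset.countP_eq_card_filter] at h
  set s := (croots (f.map (Int.castRingHom ℝ))).filter
    (fun z : ℂ => ‖z - a‖ < 2 * (n + 1) * (b - a)) with hs
  have hnd : s.Nodup := (croots_nodup hf).filter _
  obtain ⟨z, hz⟩ := Multiset.card_pos_iff_exists_mem.1 (by omega : 0 < s.card)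
  obtain ⟨z', hz'⟩ := Multiset.card_pos_iff_exists_mem.1
    (by rw [Multiset.card_erase_of_mem hz]; simp only [Nat.pred_eq_sub_one]; omega :
      0 < (s.erase z).card)
  have hne : z' ≠ z := (hnd.mem_erase_iff.1 hz').1
  have hz'm := (hnd.mem_erase_iff.1 hz').2
  rw [hs, Multiset.mem_filter] at hz hz'm
  have hsep := separation hf hτ1 hτ hz.1 hz'm.1 hne
  have hd : ‖z - z'‖ ≤ 4 * (n + 1) * (b - a) := by
    have e : z - z' = (z - a) - (z' - a) := by ring
    rw [e]
    refine (norm_sub_le _ _).trans ?_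
    linarith [hz.2, hz'm.2]
  have hn2 : 1 ≤ n := by
    have h1 := Multiset.card_pos_iff_exists_mem.2 ⟨z, hz.1⟩
    rwa [card_croots, natDegree_map_eq_of_injective hinj] at h1
  have hpow : (4 * (n + 1) : ℝ) ≤ 2 ^ (4 * τ * n ^ 2) := by
    have h1 : n + 1 ≤ 2 ^ n := Nat.lt_two_pow_self
    have h2 : (n : ℝ) + 1 ≤ 2 ^ n := by exact_mod_cast h1
    have h3 : n + 2 ≤ 4 * τ * n ^ 2 := by nlinarith [Nat.mul_le_mul_right (n ^ 2) hτ1]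
    calc (4 * (n + 1) : ℝ) ≤ 2 ^ 2 * 2 ^ n := by linarith
      _ = 2 ^ (n + 2) := by rw [pow_add]; ring
      _ ≤ _ := pow_le_pow_right₀ (by norm_num) h3
  have hw : 0 ≤ b - a := by linarith
  calc (1 : ℝ) ≤ 2 ^ (4 * τ * n ^ 2) * ‖z - z'‖ := hsep
    _ ≤ 2 ^ (4 * τ * n ^ 2) * (2 ^ (4 * τ * n ^ 2) * (b - a)) := by
        gcongr
        exact hd.trans (mul_le_mul_of_nonneg_right hpow hw)
    _ = 2 ^ (8 * τ * n ^ 2) * (b - a) := by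
        rw [← mul_assoc, ← pow_add]; congr 2; ring

/-! ### Clusters of roots and the Newton iterate. -/

theorem norm_sum_map_le {α : Type*} {s : Multiset α} {g : α → ℂ} {B : ℝ}
    (h : ∀ z ∈ s, ‖g z‖ ≤ B) : ‖(s.map g).sum‖ ≤ s.card * B := by
  induction s using Multiset.induction_on with
  | empty => simp
  | cons a s ih =>
    rw [Multiset.map_cons, Multiset.sum_cons, Multiset.card_cons]
    have h1 := h a (Multiset.mem_cons_self a s)
    have h2 := ih fun z hz => h z (Multiset.mem_cons_of_mem hz)
    refine (norm_add_le _ _).trans ?_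
    push_cast
    linarith

theorem eval_map_ofReal (f : ℝ[X]) (a : ℝ) :
    (f.map (algebraMap ℝ ℂ)).eval (a : ℂ) = ((f.eval a : ℝ) : ℂ) := by
  rw [eval_map_algebraMap]
  exact (Polynomial.aeval_algebraMap_apply_eq_algebraMap_eval a f)

theorem derivative_div_eval_eq_sum {f : ℝ[X]} {a : ℝ} (ha : f.eval a ≠ 0) :
    ((f.derivative.eval a / f.eval a : ℝ) : ℂ) =
      ((croots f).map (fun z => 1 / ((a : ℂ) - z))).sum := by
  have hc : (f.map (algebraMap ℝ ℂ)).eval (a : ℂ) ≠ 0 := by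
    rw [eval_map_ofReal]; exact_mod_cast ha
  have := (IsAlgClosed.splits (f.map (algebraMap ℝ ℂ))).eval_derivative_div_eval_of_ne_zero hc
  rw [derivative_map, eval_map_ofReal, eval_map_ofReal] at this
  rw [croots, ← this]
  push_cast
  rfl

open Classical in
/-- The Newton iterate for a cluster of `v` roots near `ξ`, started at a point `a` that is far away
from the other roots compared to the distance of `ξ`. -/
theorem newton_iterate_close {f : ℝ[X]} (hf : f ≠ 0) {a ξ r D : ℝ} {v : ℕ} (hv : 1 ≤ v)
    (p : ℂ → Prop) (hcount : (croots f).countP p = v) (hξ : a < ξ) (hD : 0 < D)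
    (hp : ∀ z ∈ croots f, p z → ‖z - ξ‖ ≤ r) (hq : ∀ z ∈ croots f, ¬ p z → D ≤ ‖z - a‖)
    (hr : 4 * r ≤ ξ - a) (hn : 4 * ((ξ - a) * f.natDegree) ≤ D) :
    |a - v * (f.eval a / f.derivative.eval a) - ξ| ≤
      4 * r + 3 * ((ξ - a) ^ 2 * f.natDegree / D) := by
  set d := ξ - a with hd
  have hd0 : 0 < d := by linarith
  have hr0 : 0 ≤ r := by
    obtain ⟨z, hz, hpz⟩ := Multiset.countP_pos.1 (by omega : 0 < (croots f).countP p)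
    exact (norm_nonneg _).trans (hp z hz hpz)
  have haz : ∀ z ∈ croots f, p z → 3 * d / 4 ≤ ‖(a : ℂ) - z‖ := by
    intro z hz hpz
    have h1 := hp z hz hpz
    have h2 : ‖(ξ : ℂ) - a‖ = d := by
      rw [← Complex.ofReal_sub, Complex.norm_real, Real.norm_of_nonneg hd0.le]
    have h3 : ‖(ξ : ℂ) - a‖ ≤ ‖z - ξ‖ + ‖(a : ℂ) - z‖ := by
      rw [← norm_neg (z - ξ), ← norm_neg ((a : ℂ) - z)]
      refine le_trans (le_of_eq ?_) (norm_add_le _ _)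
      congr 1
      ring
    linarith
  have hfa : f.eval a ≠ 0 := by
    intro h0
    have hmem : (a : ℂ) ∈ croots f := by
      rw [croots, mem_roots ((Polynomial.map_ne_zero_iff (algebraMap ℝ ℂ).injective).2 hf),
        IsRoot.def, eval_map_ofReal, h0, Complex.ofReal_zero]
    by_cases hpa : p a
    · have := haz _ hmem hpa
      rw [sub_self, norm_zero] at this
      linarith
    · have := hq _ hmem hpa
      rw [sub_self, norm_zero] at this
      linarith
  set S : ℝ := f.derivative.eval a / f.eval a with hS
  have hsum := derivative_div_eval_eq_sum hfa
  rw [← hS] at hsum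
  set η : ℝ := 4 * r / (3 * d) + d * f.natDegree / D with hη
  have hvr : (1 : ℝ) ≤ v := by exact_mod_cast hv
  have hnonneg : 0 ≤ d * f.natDegree / D := by positivity
  -- In `d f'(a) / f(a) = ∑ d / (a - z)` each cluster root contributes `-1` up to `4 r / (3 d)`,
  -- every other root at most `d / D`. Hence the Newton step is close to `d`.
  have key : |d * S + v| ≤ v * η := by
    have e1 : ((d * S + v : ℝ) : ℂ) =
        (((croots f).filter p).map (fun z => d * (1 / ((a : ℂ) - z)) + 1)).sum +
        (((croots f).filter (fun z => ¬ p z)).map (fun z => d * (1 / ((a : ℂ) - z)))).sum := by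
      push_cast
      rw [hsum, ← Multiset.filter_add_not p (croots f), Multiset.map_add, Multiset.sum_add,
        Multiset.sum_map_add, Multiset.sum_map_mul_left, Multiset.sum_map_mul_left,
        Multiset.map_const', Multiset.sum_replicate, Multiset.filter_add_not p (croots f),
        ← Multiset.countP_eq_card_filter, hcount]
      simp only [nsmul_eq_mul, mul_one]
      ring
    have e2 : ‖(((croots f).filter p).map (fun z => d * (1 / ((a : ℂ) - z)) + 1)).sum‖
        ≤ v * (4 * r / (3 * d)) := by
      rw [← hcount, Multiset.countP_eq_card_filter]
      apply norm_sum_map_le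
      intro z hz
      obtain ⟨hz, hpz⟩ := Multiset.mem_filter.1 hz
      have h1 := haz z hz hpz
      have h2 := hp z hz hpz
      have h3 : (a : ℂ) - z ≠ 0 := norm_pos_iff.1 (by linarith)
      have h4 : d * (1 / ((a : ℂ) - z)) + 1 = -(z - ξ) / ((a : ℂ) - z) := by
        rw [hd]; push_cast; field_simp; ring
      rw [h4, norm_div, norm_neg, div_le_div_iff₀ (by linarith) (by linarith)]
      nlinarith [norm_nonneg (z - ξ)]
    have e3 : ‖(((croots f).filter (fun z => ¬ p z)).map (fun z => d * (1 / ((a : ℂ) - z)))).sum‖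
        ≤ f.natDegree * (d / D) := by
      refine (norm_sum_map_le (B := d / D) ?_).trans ?_
      · intro z hz
        obtain ⟨hz, hpz⟩ := Multiset.mem_filter.1 hz
        have h1 := hq z hz hpz
        rw [norm_mul, Complex.norm_real, Real.norm_of_nonneg hd0.le, norm_div, norm_one,
          norm_sub_rev, ← mul_div_assoc, mul_one]
        gcongr
      · refine mul_le_mul_of_nonneg_right ?_ (by positivity)
        rw [← card_croots]
        exact_mod_cast Multiset.card_le_card (Multiset.filter_le _ _)
    have e4 : |d * S + v| = ‖((d * S + v : ℝ) : ℂ)‖ := by rw [Complex.norm_real, Real.norm_eq_abs]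
    rw [e4, e1]
    refine (norm_add_le _ _).trans ?_
    have e5 : f.natDegree * (d / D) ≤ v * (d * f.natDegree / D) := by
      have : f.natDegree * (d / D) = d * f.natDegree / D := by ring
      rw [this]
      nlinarith
    rw [hη, mul_add]
    linarith
  have hη1 : η ≤ 7 / 12 := by
    have h1 : 4 * r / (3 * d) ≤ 1 / 3 := by
      rw [div_le_div_iff₀ (by linarith) (by norm_num)]; linarith
    have h2 : d * f.natDegree / D ≤ 1 / 4 := by
      rw [div_le_div_iff₀ hD (by norm_num)]; linarith
    linarith
  have hSneg : d * S ≤ -(5 / 12) * v := by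
    have := (abs_le.1 key).2
    nlinarith
  have hS0 : S < 0 := by
    by_contra hcon
    push Not at hcon
    nlinarith [mul_nonneg hd0.le hcon]
  have hratio : f.eval a / f.derivative.eval a = 1 / S := by rw [hS, one_div_div]
  have hfin : a - v * (f.eval a / f.derivative.eval a) - ξ = -((d * S + v) / S) := by
    rw [hratio]
    have : a = ξ - d := by rw [hd]; ring
    rw [this]
    have hSne := hS0.ne
    field_simp
    ring
  rw [hfin, abs_neg, abs_div, abs_of_neg hS0, div_le_iff₀ (by linarith)]
  refine key.trans ?_
  have hcalc : 4 * r + 3 * (d ^ 2 * f.natDegree / D) ≥ 12 / 5 * (d * η) := by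
    have : d * η = 4 * r / 3 + d ^ 2 * f.natDegree / D := by
      rw [hη]; field_simp
    rw [this]
    have : 0 ≤ d ^ 2 * f.natDegree / D := by positivity
    linarith
  have hη0 : 0 ≤ η := by positivity
  calc v * η ≤ 12 / 5 * η * (d * -S) := by nlinarith
    _ = 12 / 5 * (d * η) * -S := by ring
    _ ≤ _ := by
      refine mul_le_mul_of_nonneg_right hcalc (by linarith)

open Classical in
/-- If the `v` roots near `(c, e)` are the only ones in the rhombus over `(a₁, b₁)`, then they form
a cluster, and the remaining roots are far away from every point `a` deep inside `(a₁, b₁)`. -/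
theorem exists_cluster {f : ℝ[X]} (hf : f ≠ 0) {a₁ b₁ a c e W : ℝ} (hce : c < e) (hW : 0 < W)
    (hvar : var f c e = var f a₁ b₁)
    (ha₁ : a₁ + W / 4 ≤ a) (hb₁ : a ≤ b₁ - W / 4) (hc₁ : a₁ + W / 4 ≤ c) (hc₂ : c ≤ b₁ - W / 4)
    (hJ : 64 * (f.natDegree + 1) ^ 2 * (e - c) ≤ W) :
    (croots f).countP (fun z : ℂ => ‖z - c‖ < 2 * (f.natDegree + 1) * (e - c)) = var f c e ∧
    ∀ z ∈ croots f, ¬ ‖z - c‖ < 2 * (f.natDegree + 1) * (e - c) →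
      W / (32 * (f.natDegree + 1)) ≤ ‖z - a‖ := by
  set M : ℝ := f.natDegree + 1 with hM
  have hM1 : 1 ≤ M := by simp [hM]
  have hab₁ : a₁ < b₁ := by linarith
  have hw : 0 < e - c := by linarith
  have hlens : ∀ (x : ℝ) (z : ℂ) (ρ : ℝ), a₁ + W / 4 ≤ x → x ≤ b₁ - W / 4 → ‖z - x‖ < ρ →
      32 * M * ρ ≤ W → InLens f.natDegree a₁ b₁ z := by
    intro x z ρ hx1 hx2 hz hρ
    have h1 := (Complex.abs_re_le_norm (z - x)).trans_lt hz
    have h2 := (Complex.abs_im_le_norm (z - x)).trans_lt hz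
    simp only [Complex.sub_re, Complex.sub_im, Complex.ofReal_re, Complex.ofReal_im, sub_zero]
      at h1 h2
    obtain ⟨h3, h4⟩ := abs_lt.1 h1
    have hρ0 : 0 < ρ := (norm_nonneg _).trans_lt hz
    have h5 : 32 * ρ ≤ W := by nlinarith
    have h6 : 4 * M * |z.im| ≤ W / 8 := by nlinarith
    refine ⟨by linarith, by linarith, ?_, ?_⟩ <;> rw [← hM] <;> linarith
  have himp : ∀ z : ℂ, ‖z - c‖ < 2 * M * (e - c) → InLens f.natDegree a₁ b₁ z := by
    intro z hz
    exact hlens c z _ hc₁ hc₂ hz (by linarith)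
  -- Sandwich: `var f c e` ≤ roots in the disc ≤ roots in the rhombus ≤ `var f a₁ b₁`. Equality of
  -- the ends forces the disc and the rhombus to contain the same roots; a root close to `a` lies in
  -- the rhombus, hence in the disc.
  have h1 := var_le_countP hf hce
  have h2 := countP_inLens_le_var hf hab₁
  have h3 := countP_mono (croots f) himp
  rw [← hM] at h1
  refine ⟨by omega, ?_⟩
  intro z hz hnot
  by_contra hcon
  push Not at hcon
  have hzl := hlens a z _ ha₁ hb₁ hcon (by field_simp; exact le_rfl)
  have hle := Multiset.monotone_filter_right (croots f) himp
  have heq := Multiset.eq_of_le_of_card_le hle (by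
    rw [← Multiset.countP_eq_card_filter, ← Multiset.countP_eq_card_filter]; omega)
  have hm : z ∈ (croots f).filter (InLens f.natDegree a₁ b₁) := Multiset.mem_filter.2 ⟨hz, hzl⟩
  rw [← heq] at hm
  exact hnot (Multiset.mem_filter.1 hm).2

/-! ### Success of the Newton test. -/

theorem four_le_N {I : Node} (h : 1 ≤ I.lvl) : (4 : ℝ) ≤ I.N := by
  have h1 : 2 ^ 1 ≤ 2 ^ I.lvl := Nat.pow_le_pow_right (by norm_num) h
  have h2 : 2 ^ 2 ≤ I.N := Nat.pow_le_pow_right (by norm_num) h1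
  exact_mod_cast h2

theorem newtonIndex_bounds (rd : ℝ → ℤ) {I : Node} (hl : 1 ≤ I.lvl) (l : ℝ) :
    2 ≤ Node.newtonIndex rd I l ∧ Node.newtonIndex rd I l ≤ 4 * I.N - 2 := by
  have : (4 : ℤ) ≤ I.N := by exact_mod_cast four_le_N hl
  unfold Node.newtonIndex
  constructor
  · refine le_min (le_max_right _ _) ?_
    omega
  · exact min_le_right _ _

/-- In units of the mesh `w / (4 N)`, the iterate is within `1/8` of `c` and rounding moves it by at
most 1, so the index is within `9/8` of `c`. The chosen interval reaches 2 units to each side, and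
`e - c` is at most `1/8`. Clamping is harmless since `c` lies at a position in `[2, 4 N - 2]`. -/
theorem newton_contains_of_close {rd : ℝ → ℤ} (hrd : ∀ t, |(rd t : ℝ) - t| ≤ 1) {f : ℝ[X]}
    {I : Node} {c e : ℝ} (hw : 0 < I.width) (hN : (0 : ℝ) < I.N)
    (herr : |I.lo - I.var f * (f.eval I.lo / f.derivative.eval I.lo) - c| ≤ I.width / I.N / 32)
    (hj : 32 * (e - c) ≤ I.width / I.N) (hlo : I.width / I.N / 2 ≤ c - I.lo)
    (hhi : c ≤ I.lo + I.width - I.width / I.N / 2) :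
    (Node.newton rd f I I.lo).lo ≤ c ∧ e ≤ (Node.newton rd f I I.lo).hi := by
  have hkr : ∀ l, (Node.newtonIndex rd I l : ℝ) =
      min (max (rd (4 * I.N * ((l - I.lo) / I.width)) : ℝ) 2) (4 * I.N - 2) := by
    intro l
    rw [Node.newtonIndex]
    push_cast
    rfl
  unfold Node.newton
  simp only
  generalize I.lo - I.var f * (f.eval I.lo / f.derivative.eval I.lo) = l at *
  specialize hkr l
  generalize Node.newtonIndex rd I l = k at *
  generalize (I.N : ℝ) = N at *
  generalize I.width = w at *
  generalize I.lo = a at *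
  have hu : w / N * N = w := by field_simp
  have hq : w / (4 * N) = w / N / 4 := by field_simp
  have ht : 4 * N * ((l - a) / w) * (w / N / 4) = l - a := by field_simp
  rw [hq]
  have hrt := abs_le.1 (hrd (4 * N * ((l - a) / w)))
  generalize 4 * N * ((l - a) / w) = t at *
  have hu0 : 0 < w / N := by positivity
  generalize w / N = u at *
  obtain ⟨s, hs⟩ : ∃ s, s = (c - a) / (u / 4) := ⟨_, rfl⟩
  have hsu : s * (u / 4) = c - a := by rw [hs]; field_simp
  have hts : |t - s| ≤ 1 / 8 := by
    have h1 : (t - s) * (u / 4) = l - c := by rw [sub_mul, ht, hsu]; ring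
    have h2 : |t - s| * (u / 4) = |l - c| := by
      rw [← h1, abs_mul, abs_of_pos (by positivity : 0 < u / 4)]
    by_contra hcon
    push Not at hcon
    nlinarith
  have hs2 : 2 ≤ s := by
    rw [hs, le_div_iff₀ (by positivity)]; linarith
  have hs3 : s ≤ 4 * N - 2 := by
    rw [hs, div_le_iff₀ (by positivity)]
    have : (4 * N - 2) * (u / 4) = w - u / 2 := by rw [← hu]; ring
    rw [this]
    linarith
  have hts' := abs_le.1 hts
  have hk1 : s - 9 / 8 ≤ k := by
    rw [hkr]
    refine le_min ((?_ : _ ≤ _).trans (le_max_left _ _)) (by linarith)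
    linarith
  have hk2 : (k : ℝ) ≤ s + 9 / 8 := by
    rw [hkr]
    refine (min_le_left _ _).trans (max_le ?_ (by linarith))
    linarith
  constructor
  · have : (k - 2) * (u / 4) ≤ s * (u / 4) :=
      mul_le_mul_of_nonneg_right (by linarith) (by positivity)
    linarith
  · have : (s + 7 / 8) * (u / 4) ≤ (k + 2) * (u / 4) :=
      mul_le_mul_of_nonneg_right (by linarith) (by positivity)
    linarith

/-- The Newton step succeeds once the cluster is well separated. -/
theorem newton_contains {rd : ℝ → ℤ} (hrd : ∀ t, |(rd t : ℝ) - t| ≤ 1) {f : ℝ[X]} (hf : f ≠ 0)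
    {I : Node} (hl : 1 ≤ I.lvl) {a₁ b₁ c e W K : ℝ} (hI : I.lo < I.hi)
    (hc : I.lo ≤ c) (hce : c < e) (he : e ≤ I.hi)
    (hv : 1 ≤ I.var f) (hv1 : var f a₁ b₁ = I.var f) (hv2 : var f c e = I.var f)
    (ha₁ : a₁ + W / 4 ≤ I.lo) (hb₁ : I.hi ≤ b₁ - W / 4)
    (hK : K = 4096 * (f.natDegree + 1) ^ 2)
    (hJ : K * I.N * (e - c) ≤ I.width) (hW : K * I.N * I.width ≤ W)
    (hleft : I.lo + I.width / I.N < e) (hright : c < I.hi - I.width / I.N) :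
    (Node.newton rd f I I.lo).lo ≤ c ∧ e ≤ (Node.newton rd f I I.lo).hi := by
  classical
  have hN4 := four_le_N hl
  obtain ⟨N, hN⟩ : ∃ N : ℝ, N = (I.N : ℝ) := ⟨_, rfl⟩
  rw [← hN] at hN4 hJ hW hleft hright
  set w := I.width with hw
  have hwdef : w = I.hi - I.lo := rfl
  have hw0 : 0 < w := by rw [hwdef]; linarith
  set M : ℝ := f.natDegree + 1 with hM
  have hM1 : 1 ≤ M := by simp [hM]
  have hMM : 1 ≤ M ^ 2 := one_le_pow₀ hM1
  have hM2 : M ≤ M ^ 2 := by nlinarith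
  have hNpos : 0 < N := by linarith
  have hj : 0 < e - c := by linarith
  have hKN : 1 ≤ K * N :=
    one_le_mul_of_one_le_of_one_le (by rw [hK]; linarith) (by linarith)
  have hWpos : 0 < W := lt_of_lt_of_le (by positivity) hW
  have hwW : w ≤ W := (le_mul_of_one_le_left hw0.le hKN).trans hW
  have hNj : 4096 * M ^ 2 * (N * (e - c)) ≤ w := by rw [hK] at hJ; linarith
  have hNw : 4096 * M ^ 2 * (N * w) ≤ W := by rw [hK] at hW; linarith
  have hjN : 0 < N * (e - c) := by positivity
  have hwN : 0 < N * w := by positivity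
  have hjle : e - c ≤ N * (e - c) := le_mul_of_one_le_left hj.le (by linarith)
  have hwle : w ≤ N * w := le_mul_of_one_le_left hw0.le (by linarith)
  obtain ⟨hcount, hfar⟩ := exists_cluster hf (a := I.lo) hce hWpos (by rw [hv2, hv1]) ha₁
    (by linarith) (by linarith) (by linarith) (by
      rw [← hM]
      linarith [mul_pos (by positivity : 0 < M ^ 2) hj,
        mul_le_mul_of_nonneg_left hjle (by positivity : 0 ≤ M ^ 2)])
  rw [hv2] at hcount
  rw [← hM] at hcount hfar
  have hu : w / N * N = w := by field_simp
  set u := w / N with hudef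
  have hu0 : 0 < u := by positivity
  have hju : 4096 * M ^ 2 * (e - c) ≤ u := by
    rw [hudef, le_div_iff₀ hNpos]; linarith
  have hju' : 4096 * (e - c) ≤ u := by
    linarith [le_mul_of_one_le_left hj.le hMM]
  -- Since the left extreme subinterval does not reach `e` and `e - c` is tiny compared with `u`,
  -- the starting point `I.lo` is well separated from the cluster.
  have hd1 : u / 2 ≤ c - I.lo := by linarith
  have hd2 : c - I.lo ≤ w := by rw [hwdef]; linarith
  have hr : 4 * (2 * M * (e - c)) ≤ u / 512 := by
    linarith [mul_le_mul_of_nonneg_right hM2 hj.le]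
  have hnM : (f.natDegree : ℝ) ≤ M := by rw [hM]; linarith
  have hn0 : (0 : ℝ) ≤ f.natDegree := Nat.cast_nonneg _
  set D := W / (32 * M) with hD
  have hDpos : 0 < D := by positivity
  have hDM : D * (32 * M) = W := by rw [hD]; field_simp
  have hNwD : 128 * M * (N * w) ≤ D := by
    rw [hD, le_div_iff₀ (by positivity)]
    linarith
  have hclose := newton_iterate_close hf hv (fun z : ℂ => ‖z - c‖ < 2 * M * (e - c)) hcount
    (ξ := c) (a := I.lo) (r := 2 * M * (e - c)) (D := D) (by linarith) hDpos
    (fun z _ hz => hz.le) hfar (by linarith) (by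
      have : (c - I.lo) * f.natDegree ≤ w * M :=
        mul_le_mul hd2 hnM hn0 hw0.le
      linarith [mul_le_mul_of_nonneg_left hwle (by linarith : 0 ≤ M),
        mul_nonneg (by linarith : 0 ≤ M) hwN.le])
  set l := I.lo - I.var f * (f.eval I.lo / f.derivative.eval I.lo) with hldef
  have herr : |l - c| ≤ u / 32 := by
    refine hclose.trans ?_
    have h1 : (c - I.lo) ^ 2 * f.natDegree ≤ w ^ 2 * M := by
      have : (c - I.lo) ^ 2 ≤ w ^ 2 := pow_le_pow_left₀ (by linarith) hd2 2
      exact mul_le_mul this hnM hn0 (by positivity)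
    have h2 : (c - I.lo) ^ 2 * f.natDegree / D ≤ u / 128 := by
      rw [div_le_iff₀ hDpos]
      refine h1.trans ?_
      calc w ^ 2 * M = u / 128 * (128 * M * (N * w)) := by
            rw [← hu]; ring
        _ ≤ u / 128 * D := by gcongr
    linarith
  rw [hudef, hN] at herr hju' hd1 hright
  refine newton_contains_of_close hrd hw0 (by linarith) herr (by linarith) hd1 ?_
  have : I.lo + I.width = I.hi := by rw [← hw, hwdef]; ring
  rw [this, ← hN]
  rw [← hN] at hright
  linarith

/-! ### Counting the steps of a search with growing and halving moves. -/

/-- A step that enlarges the progress `x` by `2 ^ l` and increases the level `l`. -/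
def Grow (x l : ℕ → ℕ) (i : ℕ) : Prop := x (i + 1) = x i + 2 ^ l i ∧ l (i + 1) = l i + 1

/-- A step that enlarges the progress `x` by one and decreases the level `l`. -/
def Halve (x l : ℕ → ℕ) (i : ℕ) : Prop := x (i + 1) = x i + 1 ∧ l (i + 1) = max 1 (l i - 1)

section Steps

variable {x l : ℕ → ℕ} {m X L : ℕ}

theorem remaining_le (hX : ∀ i ≤ m, x i ≤ X)
    (hstep : ∀ i < m, Grow x l i ∨ Halve x l i) (k : ℕ) :
    ∀ i, i + k = m → k + x i ≤ X := by
  induction k with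
  | zero => intro i hi; simpa using hX i (by omega)
  | succ k ih =>
    intro i hi
    have h1 := ih (i + 1) (by omega)
    rcases hstep i (by omega) with h | h
    · have := h.1
      have := Nat.one_le_two_pow (n := l i)
      omega
    · have := h.1
      omega

/-- Close to the target, the number of remaining steps is linear in the level. -/
theorem remaining_le_of_close (hl1 : ∀ i ≤ m, 1 ≤ l i) (hX : ∀ i ≤ m, x i ≤ X)
    {i₀ : ℕ} (hstep : ∀ i, i₀ ≤ i → i < m →
      Grow x l i ∨ (Halve x l i ∧ X < x i + L + 2 ^ l i))
    (hstep' : ∀ i < m, Grow x l i ∨ Halve x l i) (k : ℕ) :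
    ∀ i, i₀ ≤ i → i + k = m →
      (X < x i + 2 * 2 ^ l i + L → k ≤ 3 * l i + L + 6) ∧
      (X < x i + 2 ^ l i + L → k ≤ 3 * l i + L + 4) ∧
      (2 * X < 2 * x i + 2 ^ l i + 2 * L → k ≤ 3 * l i + L + 2) := by
  -- Three ranges of `X - x - L`: below `2 * 2 ^ l`, `2 ^ l` and `2 ^ l / 2`. A growing step leads
  -- from the first to the third, and from the other two to fewer than `L` remaining steps. A
  -- halving step with `l ≥ 2` leads from the first two to the first, and from the third to the
  -- second, with `l` lowered by one, which pays for the step.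
  induction k with
  | zero => intro i _ _; simp
  | succ k ih =>
    intro i hi hk
    obtain ⟨a2, a1, a0⟩ := ih (i + 1) (by omega) (by omega)
    have hr := remaining_le hX hstep' (k + 1) i (by omega)
    have hr' := remaining_le hX hstep' k (i + 1) (by omega)
    have hl := hl1 i (by omega)
    rcases hstep i hi (by omega) with ⟨h1, h2⟩ | ⟨⟨h1, h2⟩, h3⟩
    · rw [h1] at hr'
      have e : 2 ^ l (i + 1) = 2 * 2 ^ l i := by rw [h2, pow_succ, mul_comm]
      rw [h1, e, h2] at a0
      refine ⟨fun h => ?_, fun h => ?_, fun h => ?_⟩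
      · have := a0 (by omega); omega
      · omega
      · omega
    · rcases Nat.lt_or_ge (l i) 2 with hlt | hge
      · have hl1' : l i = 1 := by omega
        rw [hl1'] at h3 ⊢
        refine ⟨fun h => ?_, fun h => ?_, fun h => ?_⟩ <;> omega
      · have h4 : l (i + 1) = l i - 1 := by omega
        have e : 2 ^ l i = 2 * 2 ^ l (i + 1) := by
          rw [h4, ← pow_succ']; congr 1; omega
        rw [h1] at a1 a2
        rw [e] at h3 ⊢
        have b2 := a2 (by omega)
        refine ⟨fun h => ?_, fun h => ?_, fun h => ?_⟩
        · omega
        · omega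
        · have := a1 (by omega); omega

/-- Growing steps keep `k + l i` constant; the first halving step shows that the target is close,
and `remaining_le_of_close` takes over. -/
theorem remaining_le_of_far (hl1 : ∀ i ≤ m, 1 ≤ l i) {Λ : ℕ} (hΛ : ∀ i ≤ m, l i ≤ Λ)
    (hX : ∀ i ≤ m, x i ≤ X)
    {i₀ : ℕ} (hstep : ∀ i, i₀ ≤ i → i < m →
      Grow x l i ∨ (Halve x l i ∧ X < x i + L + 2 ^ l i))
    (hstep' : ∀ i < m, Grow x l i ∨ Halve x l i) (k : ℕ) :
    ∀ i, i₀ ≤ i → i + k = m → k + l i ≤ 5 * Λ + L + 4 := by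
  induction k with
  | zero => intro i _ _; have := hΛ i (by omega); omega
  | succ k ih =>
    intro i hi hk
    have h := ih (i + 1) (by omega) (by omega)
    have hli := hΛ i (by omega)
    rcases hstep i hi (by omega) with ⟨h1, h2⟩ | ⟨h1, h3⟩
    · omega
    · have := (remaining_le_of_close hl1 hX hstep hstep' (k + 1) i hi hk).2.1 (by omega)
      omega

/-- Bookkeeping for the initial steps: `q` is the smallest level so far and `E` counts the halving
steps that did not lower `q`. -/
theorem initial_steps (hl1 : ∀ i ≤ m, 1 ≤ l i) (hstep' : ∀ i < m, Grow x l i ∨ Halve x l i) :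
    ∀ i ≤ m, ∃ q E : ℕ, 1 ≤ q ∧ q ≤ l i ∧ q ≤ l 0 ∧ 2 ^ l i ≤ x i + 2 ^ q ∧
      (E = 0 ∨ E + 2 ^ l i ≤ x i + 2) ∧ i + l 0 ≤ 2 * ((l 0 - q) + E) + l i := by
  -- Levels above `q` are paid for by `x`, so `2 ^ l i ≤ x i + 2 ^ q`. There are exactly `(l 0 - q)
  -- + E` halving steps; the last inequality counts all steps through the net change of the level.
  intro i
  induction i with
  | zero =>
    intro h
    exact ⟨l 0, 0, hl1 0 h, le_rfl, le_rfl, by omega, Or.inl rfl, by omega⟩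
  | succ i ih =>
    intro hi
    obtain ⟨q, E, h1, h2, h3, h4, h5, h6⟩ := ih (by omega)
    have hl := hl1 i (by omega)
    rcases hstep' i (by omega) with ⟨g1, g2⟩ | ⟨g1, g2⟩
    · have e : 2 ^ l (i + 1) = 2 * 2 ^ l i := by rw [g2, pow_succ, mul_comm]
      refine ⟨q, E, h1, by omega, h3, by omega, ?_, by omega⟩
      rcases h5 with h5 | h5
      · exact Or.inl h5
      · right; omega
    · rcases Nat.lt_or_ge (l i) 2 with hlt | hge
      · have hl' : l i = 1 := by omega
        have hl'' : l (i + 1) = 1 := by omega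
        have hq : q = 1 := by omega
        subst hq
        rw [hl'] at h2 h4 h5 h6
        refine ⟨1, E + 1, by omega, by omega, by omega, ?_, ?_, ?_⟩
        · rw [hl'']; omega
        · right; rw [hl'']; omega
        · omega
      · have hl'' : l (i + 1) = l i - 1 := by omega
        have e : 2 ^ l i = 2 * 2 ^ l (i + 1) := by
          rw [hl'', ← pow_succ']; congr 1; omega
        rcases h2.eq_or_lt with hq | hq
        · refine ⟨q - 1, E, by omega, by omega, by omega, ?_, ?_, ?_⟩
          · rw [hl'', hq]; omega
          · rcases h5 with h5 | h5
            · exact Or.inl h5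
            · right; omega
          · omega
        · have hqp : 2 ^ q ≤ 2 ^ l (i + 1) := Nat.pow_le_pow_right (by norm_num) (by omega)
          refine ⟨q, E + 1, h1, by omega, h3, by omega, ?_, by omega⟩
          right
          rcases h5 with h5 | h5 <;> omega

/-- The condition `L + 2 ^ l i ≤ x i` persists once reached, and `initial_steps` bounds the time
before it. Afterwards halving is possible only near the target, so `remaining_le_of_far` applies. -/
theorem steps_le (hl1 : ∀ i ≤ m, 1 ≤ l i) {Λ : ℕ} (hΛ : ∀ i ≤ m, l i ≤ Λ)
    (hX : ∀ i ≤ m, x i ≤ X)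
    (hstep : ∀ i < m, Grow x l i ∨
      (Halve x l i ∧ (x i < L + 2 ^ l i ∨ X < x i + L + 2 ^ l i))) :
    m ≤ 8 * Λ + 3 * L + 10 := by
  have hstep' : ∀ i < m, Grow x l i ∨ Halve x l i := fun i hi => (hstep i hi).imp id And.left
  have hinit : ∀ i ≤ m, x i < L + 2 ^ l i → i ≤ 3 * Λ + 2 * L + 2 := by
    intro i hi h
    obtain ⟨q, E, h1, h2, h3, h4, h5, h6⟩ := initial_steps hl1 hstep' i hi
    have := hΛ i hi
    have := hΛ 0 (by omega)
    omega
  have hmono : ∀ i j, i ≤ j → j ≤ m → L + 2 ^ l i ≤ x i → L + 2 ^ l j ≤ x j := by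
    intro i j hij
    induction j, hij using Nat.le_induction with
    | base => intro _ h; exact h
    | succ j hj ih =>
      intro hjm h
      have hx := ih (by omega) h
      have hl := hl1 j (by omega)
      rcases hstep' j (by omega) with ⟨g1, g2⟩ | ⟨g1, g2⟩
      · rw [g1, g2, pow_succ]; omega
      · have : 2 ^ l (j + 1) ≤ 2 ^ l j := Nat.pow_le_pow_right (by norm_num) (by omega)
        omega
  by_contra hcon
  push Not at hcon
  set t := 3 * Λ + 2 * L + 3 with ht
  have htm : t ≤ m := by omega
  have hgood : L + 2 ^ l t ≤ x t := by
    by_contra h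
    have := hinit t htm (by omega)
    omega
  have hfar := remaining_le_of_far hl1 hΛ hX (i₀ := t) (L := L) (fun i hi him => by
    rcases hstep i him with h | ⟨h1, h2 | h2⟩
    · exact Or.inl h
    · have := hmono t i hi him.le hgood
      omega
    · exact Or.inr ⟨h1, h2⟩) hstep' (m - t) t le_rfl (by omega)
  omega

end Steps

/-- Bound for the number of steps of a search in which the width shrinks by the factor
`2 ^ 2 ^ l` or by the factor `2`, the latter only close to one of the ends of the scale. -/
theorem width_steps_le {w : ℕ → ℝ} {l : ℕ → ℕ} {m L Λ : ℕ} {W : ℝ} (hW : 0 < W)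
    (hl1 : ∀ i ≤ m, 1 ≤ l i) (hΛ : ∀ i ≤ m, l i ≤ Λ) (hwW : ∀ i ≤ m, W ≤ w i)
    (hstep : ∀ i < m, (w (i + 1) = w i / 2 ^ 2 ^ l i ∧ l (i + 1) = l i + 1) ∨
      (w (i + 1) = w i / 2 ∧ l (i + 1) = max 1 (l i - 1) ∧
        (w 0 < 2 ^ L * 2 ^ 2 ^ l i * w i ∨ w i < 2 ^ L * 2 ^ 2 ^ l i * W))) :
    m ≤ 8 * Λ + 3 * L + 10 := by
  -- `x i` is the binary logarithm of `w 0 / w i`; below, `X` is the integer part of that of `w 0 /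
  -- W`.
  set x : ℕ → ℕ := fun i => ∑ j ∈ Finset.range i, if l (j + 1) = l j + 1 then 2 ^ l j else 1 with hx
  have hxs : ∀ i, x (i + 1) = x i + if l (i + 1) = l i + 1 then 2 ^ l i else 1 := by
    intro i; simp only [hx]; rw [Finset.sum_range_succ]
  have hw : ∀ i ≤ m, w i * 2 ^ x i = w 0 := by
    intro i
    induction i with
    | zero => intro _; simp [hx]
    | succ i ih =>
      intro hi
      rw [← ih (by omega), hxs]
      rcases hstep i (by omega) with ⟨h1, h2⟩ | ⟨h1, h2, -⟩
      · rw [if_pos h2, h1, pow_add]; field_simp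
      · rw [if_neg (by have := hl1 i (by omega); omega), h1, pow_add]; field_simp
  have hw0 : W ≤ w 0 := hwW 0 (by omega)
  have hq : 1 ≤ w 0 / W := (one_le_div hW).2 hw0
  obtain ⟨X, hX1, hX2⟩ := exists_nat_pow_near hq (one_lt_two)
  rw [le_div_iff₀ hW] at hX1
  rw [div_lt_iff₀ hW] at hX2
  have hpow : ∀ {a b : ℕ}, (2 : ℝ) ^ a < 2 ^ b → a < b := fun h =>
    (pow_lt_pow_iff_right₀ one_lt_two).1 h
  refine steps_le (x := x) (X := X) hl1 hΛ ?_ ?_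
  · intro i hi
    have h1 := hw i hi
    have h2 : (2 : ℝ) ^ x i * W < 2 ^ (X + 1) * W := by
      refine lt_of_le_of_lt ?_ hX2
      rw [← h1, mul_comm]
      exact mul_le_mul_of_nonneg_right (hwW i hi) (by positivity)
    have := hpow (lt_of_mul_lt_mul_right h2 hW.le)
    omega
  · intro i hi
    rcases hstep i hi with ⟨h1, h2⟩ | ⟨h1, h2, h3⟩
    · left
      exact ⟨by rw [hxs, if_pos h2], h2⟩
    · right
      have hl := hl1 i (by omega)
      refine ⟨⟨by rw [hxs, if_neg (by omega)], h2⟩, ?_⟩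
      have hwi := hw i hi.le
      have hwpos : 0 < w i := hW.trans_le (hwW i hi.le)
      rcases h3 with h3 | h3
      · left
        rw [← hwi, mul_comm, ← pow_add] at h3
        exact hpow (lt_of_mul_lt_mul_right h3 hwpos.le)
      · right
        have h4 : (2 : ℝ) ^ X * W < 2 ^ (x i + L + 2 ^ l i) * W := by
          refine lt_of_le_of_lt hX1 ?_
          rw [← hwi]
          calc w i * 2 ^ x i < 2 ^ L * 2 ^ 2 ^ l i * W * 2 ^ x i := by gcongr
            _ = _ := by rw [pow_add, pow_add]; ring
        exact hpow (lt_of_mul_lt_mul_right h4 hW.le)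

/-! ### Geometry of the children of a node. -/

namespace Node

/-- A nonempty interval with positive level. -/
def Proper (I : Node) : Prop := I.lo < I.hi ∧ 1 ≤ I.lvl

theorem Proper.width_pos {I : Node} (h : I.Proper) : 0 < I.width := sub_pos.2 h.1

theorem cast_N (I : Node) : (I.N : ℝ) = 2 ^ 2 ^ I.lvl := by simp [N]

/-- A child whose width is that of its parent divided by `N`. -/
def IsShrunk (I J : Node) : Prop :=
  J.width = I.width / I.N ∧ J.lvl = I.lvl + 1 ∧ I.lo ≤ J.lo ∧ J.hi ≤ I.hi ∧
    (J.lo = I.lo ∨ J.width / 4 ≤ J.lo - I.lo) ∧ (J.hi = I.hi ∨ J.width / 4 ≤ I.hi - J.hi)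

theorem width_div_N_le {I : Node} (h : I.Proper) : I.width / I.N ≤ I.width / 4 :=
  div_le_div_of_nonneg_left h.width_pos.le (by norm_num) (four_le_N h.2)

theorem isShrunk_leftEnd {I : Node} (h : I.Proper) : IsShrunk I I.leftEnd := by
  have h1 := width_div_N_le h
  have h2 := h.width_pos
  have h3 : 0 < I.width / I.N := div_pos h2 (by linarith [four_le_N h.2])
  have h4 : I.width = I.hi - I.lo := rfl
  have e : I.leftEnd.width = I.width / I.N := by simp [width, leftEnd]
  refine ⟨e, rfl, le_rfl, ?_, Or.inl rfl, Or.inr ?_⟩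
  · change I.lo + I.width / I.N ≤ I.hi
    linarith
  · rw [e]
    change _ ≤ I.hi - (I.lo + I.width / I.N)
    linarith

theorem isShrunk_rightEnd {I : Node} (h : I.Proper) : IsShrunk I I.rightEnd := by
  have h1 := width_div_N_le h
  have h2 := h.width_pos
  have h3 : 0 < I.width / I.N := div_pos h2 (by linarith [four_le_N h.2])
  have h4 : I.width = I.hi - I.lo := rfl
  have e : I.rightEnd.width = I.width / I.N := by simp [width, rightEnd]
  refine ⟨e, rfl, ?_, le_rfl, Or.inr ?_, Or.inl rfl⟩
  · change I.lo ≤ I.hi - I.width / I.N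
    linarith
  · rw [e]
    change _ ≤ I.hi - I.width / I.N - I.lo
    linarith

/-- The mesh is a quarter of the child's width: the child either has an extreme index and shares an
endpoint with `I`, or stays at least one mesh away. -/
theorem isShrunk_newton (rd : ℝ → ℤ) (f : ℝ[X]) {I : Node} (h : I.Proper) (t : ℝ) :
    IsShrunk I (newton rd f I t) := by
  have h2 := h.width_pos
  have hN := four_le_N h.2
  have h4 : I.width = I.hi - I.lo := rfl
  unfold newton
  simp only
  have hk := newtonIndex_bounds rd h.2 (t - I.var f * (f.eval t / f.derivative.eval t))
  generalize newtonIndex rd I (t - I.var f * (f.eval t / f.derivative.eval t)) = k at hk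
  obtain ⟨hk1, hk2⟩ := hk
  obtain ⟨q, hq⟩ : ∃ q, q = I.width / (4 * I.N) := ⟨_, rfl⟩
  have hq0 : 0 < q := by rw [hq]; positivity
  have hqN : q * (4 * I.N) = I.width := by rw [hq]; field_simp
  have hqN' : I.width / I.N = 4 * q := by rw [hq]; field_simp
  have hw : (⟨I.lo + (k - 2) * q, I.lo + (k + 2) * q, I.lvl + 1⟩ : Node).width = 4 * q := by
    simp only [width]; ring
  have hhi : ((4 * I.N - 2 : ℤ) + 2 : ℝ) * q = I.width := by
    rw [← hqN]; push_cast; ring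
  rw [← hq]
  refine ⟨by rw [hw, hqN'], rfl, ?_, ?_, ?_, ?_⟩
  · have : (2 : ℝ) ≤ k := by exact_mod_cast hk1
    simp only
    nlinarith
  · have : (k : ℝ) ≤ (4 * I.N - 2 : ℤ) := by exact_mod_cast hk2
    simp only
    nlinarith
  · rw [hw]
    rcases hk1.eq_or_lt with h0 | h0
    · left; rw [← h0]; simp
    · right
      have : (3 : ℝ) ≤ k := by exact_mod_cast h0
      simp only
      nlinarith
  · rw [hw]
    rcases hk2.eq_or_lt with h0 | h0
    · left
      simp only
      rw [h0, hhi]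
      linarith
    · right
      have : (k : ℝ) + 1 ≤ (4 * I.N - 2 : ℤ) := by exact_mod_cast h0
      simp only
      nlinarith

theorem isShrunk_proper {I J : Node} (h : I.Proper) (hJ : IsShrunk I J) : J.Proper := by
  have h3 : 0 < I.width / I.N := div_pos h.width_pos (by linarith [four_le_N h.2])
  rw [← hJ.1] at h3
  exact ⟨sub_pos.1 h3, by rw [hJ.2.1]; omega⟩

/-- The outcome of the subdivision of a node, as seen from one of the children. -/
theorem children_cases {rd : ℝ → ℤ} {f : ℝ[X]} {I J : Node} (h : I.Proper)
    (hJ : J ∈ I.children rd f) : 2 ≤ I.var f ∧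
    ((IsShrunk I J ∧ J.var f = I.var f ∧ I.children rd f = [J]) ∨
      ((J = I.leftHalf ∨ J = I.rightHalf) ∧ I.children rd f = [I.leftHalf, I.rightHalf] ∧
        I.leftEnd.var f ≠ I.var f ∧ I.rightEnd.var f ≠ I.var f ∧
        (newton rd f I I.lo).var f ≠ I.var f)) := by
  unfold children at hJ ⊢
  simp only at hJ ⊢
  split_ifs at hJ ⊢ with h0 h1 h2 h3 h4
  · simp at hJ
  all_goals refine ⟨by omega, ?_⟩
  · obtain rfl := List.mem_singleton.1 hJ
    exact Or.inl ⟨isShrunk_leftEnd h, h1, rfl⟩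
  · obtain rfl := List.mem_singleton.1 hJ
    exact Or.inl ⟨isShrunk_rightEnd h, h2, rfl⟩
  · obtain rfl := List.mem_singleton.1 hJ
    exact Or.inl ⟨isShrunk_newton rd f h _, h3, rfl⟩
  · obtain rfl := List.mem_singleton.1 hJ
    exact Or.inl ⟨isShrunk_newton rd f h _, h4, rfl⟩
  · refine Or.inr ⟨by simpa using hJ, rfl, h1, h2, h3⟩

theorem half_facts {I J : Node} (h : I.Proper) (hJ : J = I.leftHalf ∨ J = I.rightHalf) :
    J.width = I.width / 2 ∧ J.lvl = max 1 (I.lvl - 1) ∧ I.lo ≤ J.lo ∧ J.hi ≤ I.hi ∧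
    (J.lo = I.lo ∨ J.width / 4 ≤ J.lo - I.lo) ∧ (J.hi = I.hi ∨ J.width / 4 ≤ I.hi - J.hi) := by
  have := h.1
  rcases hJ with rfl | rfl
  · refine ⟨by simp only [width, leftHalf]; ring, rfl, le_rfl, ?_, Or.inl rfl, Or.inr ?_⟩ <;>
    simp only [width, leftHalf] <;> linarith
  · refine ⟨by simp only [width, rightHalf]; ring, rfl, ?_, le_rfl, Or.inr ?_, Or.inl rfl⟩ <;>
    simp only [width, rightHalf] <;> linarith

theorem child_facts {rd : ℝ → ℤ} {f : ℝ[X]} {I J : Node} (h : I.Proper)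
    (hJ : J ∈ I.children rd f) :
    J.Proper ∧ J.width < I.width ∧ I.lo ≤ J.lo ∧ J.hi ≤ I.hi ∧
    (J.lo = I.lo ∨ J.width / 4 ≤ J.lo - I.lo) ∧ (J.hi = I.hi ∨ J.width / 4 ≤ I.hi - J.hi) := by
  have hw := h.width_pos
  rcases (children_cases h hJ).2 with ⟨hs, -, -⟩ | ⟨hh, -⟩
  · refine ⟨isShrunk_proper h hs, ?_, hs.2.2⟩
    rw [hs.1]
    linarith [width_div_N_le h]
  · obtain ⟨h1, h2, h3⟩ := half_facts h hh
    refine ⟨⟨?_, by rw [h2]; exact le_max_left _ _⟩, by rw [h1]; linarith, h3⟩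
    have : 0 < J.width := by rw [h1]; linarith
    exact sub_pos.1 this

theorem var_le_of_le (f : ℝ[X]) {I J : Node} (hJ : J.lo < J.hi) (h1 : I.lo ≤ J.lo)
    (h2 : J.hi ≤ I.hi) : J.var f ≤ I.var f := var_mono f h1 hJ h2

theorem var_half_add_le (f : ℝ[X]) {I : Node} (h : I.Proper) :
    I.leftHalf.var f + I.rightHalf.var f ≤ I.var f := by
  have := h.1
  exact var_add_var_le f (a := I.lo) (m := (I.lo + I.hi) / 2) (b := I.hi)
    (by linarith) (by linarith)

end Node

/-! ### Widths and levels in the recursion tree. -/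

theorem root_proper (τ : ℕ) : (root τ).Proper := by
  refine ⟨?_, le_rfl⟩
  have : (0 : ℝ) < 2 ^ (τ + 1) := by positivity
  change -(2 : ℝ) ^ (τ + 1) < 2 ^ (τ + 1)
  linarith

theorem InTree.proper {rd : ℝ → ℤ} {f : ℝ[X]} {τ : ℕ} {I : Node} (h : InTree rd f τ I) :
    I.Proper := by
  induction h with
  | root => exact root_proper τ
  | child _ hJ ih => exact (Node.child_facts ih hJ).1

theorem InTree.width_le {rd : ℝ → ℤ} {f : ℝ[X]} {τ : ℕ} {I : Node} (h : InTree rd f τ I) :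
    I.width ≤ 2 ^ (τ + 2) := by
  induction h with
  | root =>
    change (2 : ℝ) ^ (τ + 1) - -(2 : ℝ) ^ (τ + 1) ≤ 2 ^ (τ + 2)
    rw [pow_succ 2 (τ + 1)]; linarith
  | child hI hJ ih => exact (Node.child_facts hI.proper hJ).2.1.le.trans ih

/-- If all intervals with at least two sign variations have width at least `2 ^ (-Y)`, then the
levels of such nodes are at most logarithmic in `Y`. -/
theorem InTree.lvl_le {rd : ℝ → ℤ} {f : ℝ[X]} {τ Y : ℕ}
    (hY : ∀ a b : ℝ, a < b → 2 ≤ var f a b → 1 ≤ 2 ^ Y * (b - a)) {I : Node}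
    (h : InTree rd f τ I) (hv : 2 ≤ I.var f) : I.lvl ≤ Nat.log 2 (Y + τ + 2) + 1 := by
  induction h with
  | root => exact Nat.le_add_left 1 _
  | @child I J hI hJ ih =>
    have hp := hI.proper
    obtain ⟨h2, hc⟩ := Node.children_cases hp hJ
    have hIl := ih h2
    rcases hc with ⟨hs, -, -⟩ | ⟨hh, -⟩
    · have hJp := Node.isShrunk_proper hp hs
      have h1 := hY J.lo J.hi hJp.1 hv
      have h3 : J.hi - J.lo = I.width / 2 ^ 2 ^ I.lvl := by
        rw [← Node.cast_N]; exact hs.1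
      rw [h3, ← mul_div_assoc, one_le_div (by positivity)] at h1
      have h4 : (2 : ℝ) ^ 2 ^ I.lvl ≤ 2 ^ (Y + τ + 2) := by
        refine h1.trans ?_
        rw [add_assoc, pow_add]
        gcongr
        exact hI.width_le
      have h5 : 2 ^ I.lvl ≤ Y + τ + 2 := (pow_le_pow_iff_right₀ one_lt_two).1 h4
      have h6 : I.lvl ≤ Nat.log 2 (Y + τ + 2) := Nat.le_log_of_pow_le (by norm_num) h5
      rw [hs.2.1]
      omega
    · have := (Node.half_facts hp hh).2.1
      omega

/-! ### Runs with constant number of sign variations. -/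

section Run

variable {rd : ℝ → ℤ} {f : ℝ[X]} {Q : ℕ → Node} {m : ℕ}

theorem run_proper (h0 : (Q 0).Proper) (hQ : ∀ i < m, Q (i + 1) ∈ (Q i).children rd f) :
    ∀ i ≤ m, (Q i).Proper := by
  intro i
  induction i with
  | zero => intro _; exact h0
  | succ i ih => intro hi; exact (Node.child_facts (ih (by omega)) (hQ i (by omega))).1

theorem run_nested (h0 : (Q 0).Proper) (hQ : ∀ i < m, Q (i + 1) ∈ (Q i).children rd f) {i : ℕ} :
    ∀ j, i ≤ j → j ≤ m → (Q i).lo ≤ (Q j).lo ∧ (Q j).hi ≤ (Q i).hi ∧ (Q j).width ≤ (Q i).width := by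
  intro j hij
  induction j, hij using Nat.le_induction with
  | base => intro _; exact ⟨le_rfl, le_rfl, le_rfl⟩
  | succ j hj ih =>
    intro hjm
    obtain ⟨h1, h2, h3⟩ := ih (by omega)
    obtain ⟨-, g1, g2, g3, -⟩ := Node.child_facts (run_proper h0 hQ j (by omega)) (hQ j (by omega))
    exact ⟨h1.trans g2, g3.trans h2, g1.le.trans h3⟩

/-- A moved endpoint has moved by at least a quarter of the current width, and the gap survives
because widths shrink. This provides the margin required by `newton_contains`. -/
theorem run_lo (h0 : (Q 0).Proper) (hQ : ∀ i < m, Q (i + 1) ∈ (Q i).children rd f) :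
    ∀ i ≤ m, (Q i).lo = (Q 0).lo ∨ (Q i).width / 4 ≤ (Q i).lo - (Q 0).lo := by
  intro i
  induction i with
  | zero => intro _; exact Or.inl rfl
  | succ i ih =>
    intro hi
    obtain ⟨-, g1, g2, -, g3, -⟩ :=
      Node.child_facts (run_proper h0 hQ i (by omega)) (hQ i (by omega))
    rcases ih (by omega) with h | h
    · rw [← h]; exact g3
    · right; linarith

theorem run_hi (h0 : (Q 0).Proper) (hQ : ∀ i < m, Q (i + 1) ∈ (Q i).children rd f) :
    ∀ i ≤ m, (Q i).hi = (Q 0).hi ∨ (Q i).width / 4 ≤ (Q 0).hi - (Q i).hi := by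
  intro i
  induction i with
  | zero => intro _; exact Or.inl rfl
  | succ i ih =>
    intro hi
    obtain ⟨-, g1, -, g2, -, g3⟩ :=
      Node.child_facts (run_proper h0 hQ i (by omega)) (hQ i (by omega))
    rcases ih (by omega) with h | h
    · rw [← h]; exact g3
    · right; linarith

/-- In a run with constant number of sign variations, every step either divides the width by `N`,
or it is a bisection, and then the subintervals tried before do not contain the last interval. -/
theorem run_step (h0 : (Q 0).Proper) (hQ : ∀ i < m, Q (i + 1) ∈ (Q i).children rd f)
    (hv : ∀ i ≤ m, (Q i).var f = (Q m).var f) {i : ℕ} (hi : i < m) :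
    ((Q (i + 1)).width = (Q i).width / 2 ^ 2 ^ (Q i).lvl ∧ (Q (i + 1)).lvl = (Q i).lvl + 1) ∨
    ((Q (i + 1)).width = (Q i).width / 2 ∧ (Q (i + 1)).lvl = max 1 ((Q i).lvl - 1) ∧
      (Q i).lo + (Q i).width / (Q i).N < (Q m).hi ∧ (Q m).lo < (Q i).hi - (Q i).width / (Q i).N ∧
      ¬ ((Node.newton rd f (Q i) (Q i).lo).lo ≤ (Q m).lo ∧
        (Q m).hi ≤ (Node.newton rd f (Q i) (Q i).lo).hi)) := by
  have hp := run_proper h0 hQ i hi.le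
  have hpm := run_proper h0 hQ m le_rfl
  obtain ⟨n1, n2, -⟩ := run_nested h0 hQ (i := i) m hi.le le_rfl
  -- A tested subinterval containing `Q m` would have its variations squeezed between two equal
  -- numbers, so its test could not have failed.
  have hcontain : ∀ B : Node, B.var f ≠ (Q i).var f → Node.IsShrunk (Q i) B →
      ¬ (B.lo ≤ (Q m).lo ∧ (Q m).hi ≤ B.hi) := by
    rintro B hB hs ⟨c1, c2⟩
    have h1 := Node.var_le_of_le f hpm.1 c1 c2
    have h2 := Node.var_le_of_le f (Node.isShrunk_proper hp hs).1 hs.2.2.1 hs.2.2.2.1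
    rw [hv i hi.le] at h2 hB
    exact hB (le_antisymm h2 h1)
  rcases (Node.children_cases hp (hQ i hi)).2 with ⟨hs, -, -⟩ | ⟨hh, -, e1, e2, e3⟩
  · left
    rw [← Node.cast_N]
    exact ⟨hs.1, hs.2.1⟩
  · right
    obtain ⟨g1, g2, -⟩ := Node.half_facts hp hh
    refine ⟨g1, g2, ?_, ?_, hcontain _ e3 (Node.isShrunk_newton rd f hp _)⟩
    · by_contra hcon
      exact hcontain _ e1 (Node.isShrunk_leftEnd hp) ⟨n1, not_lt.1 hcon⟩
    · by_contra hcon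
      exact hcontain _ e2 (Node.isShrunk_rightEnd hp) ⟨not_lt.1 hcon, n2⟩

/-- While the left endpoint is fixed, the search is for the distance `(Q m).hi - (Q 0).lo`. A
bisection means that the left extreme subinterval is shorter than this, so it occurs only near the
target, with `L = 0`. -/
theorem index_le_of_lo_eq (h0 : (Q 0).Proper) (hQ : ∀ i < m, Q (i + 1) ∈ (Q i).children rd f)
    (hv : ∀ i ≤ m, (Q i).var f = (Q m).var f) {Λ : ℕ} (hΛ : ∀ i ≤ m, (Q i).lvl ≤ Λ) {s : ℕ}
    (hs : s ≤ m) (hlo : (Q s).lo = (Q 0).lo) : s ≤ 8 * Λ + 10 := by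
  have hpm := run_proper h0 hQ m le_rfl
  have hlo' : ∀ i ≤ s, (Q i).lo = (Q 0).lo := by
    intro i hi
    have h1 := (run_nested h0 hQ (i := i) s hi hs).1
    have h2 := (run_nested h0 hQ (i := 0) i (Nat.zero_le _) (by omega)).1
    linarith
  refine width_steps_le (w := fun i => (Q i).width) (l := fun i => (Q i).lvl) (L := 0)
    (W := (Q m).hi - (Q 0).lo) ?_ (fun i hi => (run_proper h0 hQ i (by omega)).2)
    (fun i hi => hΛ i (by omega)) ?_ ?_
  · have := (run_nested h0 hQ (i := 0) m (Nat.zero_le _) le_rfl).1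
    linarith [hpm.1]
  · intro i hi
    have := (run_nested h0 hQ (i := i) m (by omega) le_rfl).2.1
    have e : (Q i).width = (Q i).hi - (Q i).lo := rfl
    rw [e, hlo' i hi]
    linarith
  · intro i hi
    rcases run_step h0 hQ hv (i := i) (by omega) with h | ⟨h1, h2, h3, -⟩
    · exact Or.inl h
    · refine Or.inr ⟨h1, h2, Or.inr ?_⟩
      rw [hlo' i hi.le, Node.cast_N] at h3
      rw [pow_zero, one_mul, mul_comm, ← div_lt_iff₀ (by positivity)]
      linarith

theorem index_le_of_hi_eq (h0 : (Q 0).Proper) (hQ : ∀ i < m, Q (i + 1) ∈ (Q i).children rd f)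
    (hv : ∀ i ≤ m, (Q i).var f = (Q m).var f) {Λ : ℕ} (hΛ : ∀ i ≤ m, (Q i).lvl ≤ Λ) {s : ℕ}
    (hs : s ≤ m) (hhi : (Q s).hi = (Q 0).hi) : s ≤ 8 * Λ + 10 := by
  have hpm := run_proper h0 hQ m le_rfl
  have hhi' : ∀ i ≤ s, (Q i).hi = (Q 0).hi := by
    intro i hi
    have h1 := (run_nested h0 hQ (i := i) s hi hs).2.1
    have h2 := (run_nested h0 hQ (i := 0) i (Nat.zero_le _) (by omega)).2.1
    linarith
  refine width_steps_le (w := fun i => (Q i).width) (l := fun i => (Q i).lvl) (L := 0)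
    (W := (Q 0).hi - (Q m).lo) ?_ (fun i hi => (run_proper h0 hQ i (by omega)).2)
    (fun i hi => hΛ i (by omega)) ?_ ?_
  · have := (run_nested h0 hQ (i := 0) m (Nat.zero_le _) le_rfl).2.1
    linarith [hpm.1]
  · intro i hi
    have := (run_nested h0 hQ (i := i) m (by omega) le_rfl).1
    have e : (Q i).width = (Q i).hi - (Q i).lo := rfl
    rw [e, hhi' i hi]
    linarith
  · intro i hi
    rcases run_step h0 hQ hv (i := i) (by omega) with h | ⟨h1, h2, -, h3, -⟩
    · exact Or.inl h
    · refine Or.inr ⟨h1, h2, Or.inr ?_⟩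
      rw [hhi' i hi.le, Node.cast_N] at h3
      rw [pow_zero, one_mul, mul_comm, ← div_lt_iff₀ (by positivity)]
      linarith

/-- A run with constant number of sign variations is short. -/
theorem run_length_le (hrd : ∀ t, |(rd t : ℝ) - t| ≤ 1) (hf : f ≠ 0) (h0 : (Q 0).Proper)
    (hQ : ∀ i < m, Q (i + 1) ∈ (Q i).children rd f)
    (hv : ∀ i ≤ m, (Q i).var f = (Q m).var f) (hv1 : 1 ≤ (Q m).var f) {Λ L : ℕ}
    (hΛ : ∀ i ≤ m, (Q i).lvl ≤ Λ) (hL : 4096 * ((f.natDegree : ℝ) + 1) ^ 2 ≤ 2 ^ L) :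
    m ≤ 16 * Λ + 3 * L + 21 := by
  by_contra hcon
  push Not at hcon
  have hpm := run_proper h0 hQ m le_rfl
  -- One step more than the bounds for a fixed endpoint: by now both endpoints have moved.
  set t := 8 * Λ + 11 with ht
  have htm : t ≤ m := by omega
  have hlo : (Q t).width / 4 ≤ (Q t).lo - (Q 0).lo := by
    rcases run_lo h0 hQ t htm with h | h
    · have := index_le_of_lo_eq h0 hQ hv hΛ htm h
      omega
    · exact h
  have hhi : (Q t).width / 4 ≤ (Q 0).hi - (Q t).hi := by
    rcases run_hi h0 hQ t htm with h | h
    · have := index_le_of_hi_eq h0 hQ hv hΛ htm h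
      omega
    · exact h
  have hrest : m - t ≤ 8 * Λ + 3 * L + 10 := by
    refine width_steps_le (w := fun i => (Q (t + i)).width) (l := fun i => (Q (t + i)).lvl)
      (W := (Q m).width) hpm.width_pos (fun i hi => (run_proper h0 hQ (t + i) (by omega)).2)
      (fun i hi => hΛ (t + i) (by omega))
      (fun i hi => (run_nested h0 hQ (i := t + i) m (by omega) le_rfl).2.2) ?_
    intro i hi
    rcases run_step h0 hQ hv (i := t + i) (by omega) with h | ⟨h1, h2, h3, h4, h5⟩
    · exact Or.inl h
    · refine Or.inr ⟨h1, h2, ?_⟩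
      -- With the width far from both `(Q t).width` and `(Q m).width`, the Newton test at the left
      -- endpoint would have contained `Q m`, contradicting the bisection. `Q 0` serves as the large
      -- interval.
      by_contra hbad
      push Not at hbad
      obtain ⟨b1, b2⟩ := hbad
      have hp := run_proper h0 hQ (t + i) (by omega)
      obtain ⟨n1, n2, -⟩ := run_nested h0 hQ (i := t + i) m (by omega) le_rfl
      obtain ⟨k1, k2, -⟩ := run_nested h0 hQ (i := t) (t + i) (by omega) (by omega)
      apply h5
      have hw := hp.width_pos
      have hwm := hpm.width_pos
      rw [← Node.cast_N] at b1 b2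
      refine newton_contains hrd hf hp.2 (a₁ := (Q 0).lo) (b₁ := (Q 0).hi) (W := (Q t).width)
        hp.1 n1 hpm.1 n2 (by rw [hv _ (by omega)]; exact hv1)
        ((hv 0 (by omega)).trans (hv _ (by omega)).symm) (hv _ (by omega)).symm
        (by linarith) (by linarith) rfl ?_ ?_ h3 h4
      · refine le_trans ?_ b2
        change _ * ((Q m).width) ≤ _
        gcongr
      · refine le_trans ?_ b1
        gcongr
  omega

end Run

/-! ### From chains of special nodes to runs on a path. -/

theorem InTree.exists_path {rd : ℝ → ℤ} {f : ℝ[X]} {τ : ℕ} {J : Node} (h : InTree rd f τ J) :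
    ∃ (k : ℕ) (P : ℕ → Node), P 0 = Dsc2.root τ ∧ P k = J ∧
      ∀ i < k, P (i + 1) ∈ (P i).children rd f := by
  induction h with
  | root => exact ⟨0, fun _ => Dsc2.root τ, rfl, rfl, by simp⟩
  | @child I J _ hJ ih =>
    obtain ⟨k, P, h0, hk, hP⟩ := ih
    refine ⟨k + 1, fun i => if i ≤ k then P i else J, by simpa using h0, by simp, ?_⟩
    intro i hi
    rcases Nat.lt_or_ge i k with h | h
    · simpa [h.le, Nat.succ_le_of_lt h] using hP i h
    · obtain rfl : i = k := by omega
      simpa [hk] using hJ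

section Path

variable {rd : ℝ → ℤ} {f : ℝ[X]} {τ k : ℕ} {P : ℕ → Node}

theorem path_inTree (h0 : P 0 = root τ) (hP : ∀ i < k, P (i + 1) ∈ (P i).children rd f) :
    ∀ i ≤ k, InTree rd f τ (P i) := by
  intro i
  induction i with
  | zero => intro _; rw [h0]; exact InTree.root
  | succ i ih => intro hi; exact InTree.child (ih (by omega)) (hP i (by omega))

theorem disjoint_of_mem_children {I A B : Node} (h : I.Proper) (hA : A ∈ I.children rd f)
    (hB : B ∈ I.children rd f) (hne : A ≠ B) : A.hi ≤ B.lo ∨ B.hi ≤ A.lo := by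
  rcases (Node.children_cases h hA).2 with ⟨-, -, hc⟩ | ⟨hA', hc, -⟩
  · rw [hc] at hB
    exact absurd (List.mem_singleton.1 hB).symm hne
  · rw [hc] at hB
    simp only [List.mem_cons, List.not_mem_nil, or_false] at hB
    rcases hA' with rfl | rfl <;> rcases hB with rfl | rfl
    · exact absurd rfl hne
    · exact Or.inl le_rfl
    · exact Or.inr le_rfl
    · exact absurd rfl hne

/-- Every node of the tree lies on a given path, is disjoint from the last node of the path, or is
narrower than that node. -/
theorem mem_path_or (h0 : P 0 = root τ) (hP : ∀ i < k, P (i + 1) ∈ (P i).children rd f) {I : Node}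
    (hI : InTree rd f τ I) :
    (∃ i ≤ k, I = P i) ∨ (I.hi ≤ (P k).lo ∨ (P k).hi ≤ I.lo) ∨ I.width < (P k).width := by
  induction hI with
  | root => exact Or.inl ⟨0, Nat.zero_le _, h0.symm⟩
  | @child I J hI hJ ih =>
    obtain ⟨-, hw, hl, hh, -⟩ := Node.child_facts hI.proper hJ
    rcases ih with ⟨i, hi, rfl⟩ | (h | h) | h
    · rcases hi.eq_or_lt with rfl | hi
      · exact Or.inr (Or.inr hw)
      · by_cases hJP : J = P (i + 1)
        · exact Or.inl ⟨i + 1, hi, hJP⟩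
        · have hroot : (P 0).Proper := by rw [h0]; exact root_proper τ
          obtain ⟨n1, n2, -⟩ := run_nested hroot hP (i := i + 1) k hi le_rfl
          rcases disjoint_of_mem_children hI.proper hJ (hP i hi) hJP with h | h
          · exact Or.inr (Or.inl (Or.inl (h.trans n1)))
          · exact Or.inr (Or.inl (Or.inr (n2.trans h)))
    · exact Or.inr (Or.inl (Or.inl (hh.trans h)))
    · exact Or.inr (Or.inl (Or.inr (h.trans hl)))
    · exact Or.inr (Or.inr (hw.trans h))

theorem ival_subset_iff {I J : Node} (hJ : J.lo < J.hi) :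
    J.ival ⊆ I.ival ↔ I.lo ≤ J.lo ∧ J.hi ≤ I.hi := Set.Ioo_subset_Ioo_iff hJ

theorem path_width_lt (h0 : (P 0).Proper) (hP : ∀ i < k, P (i + 1) ∈ (P i).children rd f)
    {i : ℕ} (hi : i < k) : (P k).width < (P i).width := by
  have h1 := (Node.child_facts (run_proper h0 hP i hi.le) (hP i hi)).2.1
  exact (run_nested h0 hP (i := i + 1) k hi le_rfl).2.2.trans_lt h1

theorem path_ival_ssubset (h0 : (P 0).Proper) (hP : ∀ i < k, P (i + 1) ∈ (P i).children rd f)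
    {i : ℕ} (hi : i < k) : (P k).ival ⊂ (P i).ival := by
  have hk := run_proper h0 hP k le_rfl
  have hpi := run_proper h0 hP i hi.le
  obtain ⟨n1, n2, -⟩ := run_nested h0 hP (i := i) k hi.le le_rfl
  have hw := path_width_lt h0 hP hi
  refine ⟨(ival_subset_iff hk.1).2 ⟨n1, n2⟩, ?_⟩
  intro h
  obtain ⟨m1, m2⟩ := (ival_subset_iff hpi.1).1 h
  simp only [Node.width] at hw
  linarith

/-- The chain of the end of a path consists of nodes of the path, and none of the nodes of the path
between an element of the chain and the end is special. -/
theorem mem_chain (h0 : P 0 = root τ) (hP : ∀ i < k, P (i + 1) ∈ (P i).children rd f)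
    (hJ : IsSpecial rd f τ (P k)) {I : Node} (hI : I ∈ chain rd f τ (P k)) :
    ∃ i < k, I = P i ∧ ∀ j, i ≤ j → j < k → ¬ IsSpecial rd f τ (P j) := by
  have hroot : (P 0).Proper := by rw [h0]; exact root_proper τ
  obtain ⟨hT, -, hns, hsub, hK⟩ := hI
  have hk := run_proper hroot hP k le_rfl
  obtain ⟨m1, m2⟩ := (ival_subset_iff hk.1).1 hsub
  have hk1 := hk.1
  rcases mem_path_or h0 hP hT with ⟨i, hi, rfl⟩ | (h | h) | h
  · rcases hi.eq_or_lt with rfl | hi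
    · exact absurd hJ hns
    · refine ⟨i, hi, rfl, ?_⟩
      intro j hij hj hsp
      refine hK _ hsp (path_ival_ssubset hroot hP hj) ?_
      obtain ⟨n1, n2, -⟩ := run_nested hroot hP (i := i) j hij hj.le
      exact (ival_subset_iff (run_proper hroot hP j hj.le).1).2 ⟨n1, n2⟩
  · linarith
  · linarith
  · simp only [Node.width] at h
    linarith

/-- Along nodes that are not special the number of sign variations is constant. -/
theorem var_eq_of_not_isSpecial (h0 : P 0 = root τ)
    (hP : ∀ i < k, P (i + 1) ∈ (P i).children rd f) (hv : 2 ≤ (P k).var f) {i : ℕ} (hi : i < k)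
    (hns : ¬ IsSpecial rd f τ (P i)) : (P (i + 1)).var f = (P i).var f := by
  have hroot : (P 0).Proper := by rw [h0]; exact root_proper τ
  have hk := run_proper hroot hP k le_rfl
  have hp := run_proper hroot hP i hi.le
  have hvar : ∀ j ≤ k, 2 ≤ (P j).var f := by
    intro j hj
    obtain ⟨n1, n2, -⟩ := run_nested hroot hP (i := j) k hj le_rfl
    exact hv.trans (Node.var_le_of_le f hk.1 n1 n2)
  have hex : ∃ J ∈ (P i).children rd f, (P i).var f ≤ J.var f := by
    by_contra hcon
    push Not at hcon
    refine hns ⟨path_inTree h0 hP i hi.le, ?_, Or.inr hcon⟩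
    have := hvar i hi.le
    unfold IsTerminal
    omega
  rcases (Node.children_cases hp (hP i hi)).2 with ⟨-, h, -⟩ | ⟨hh, hc, -⟩
  · exact h
  -- The half on the path has at least two variations, so by subadditivity the half that keeps all
  -- variations cannot be the other one.
  · obtain ⟨J, hJ, hJv⟩ := hex
    have hadd := Node.var_half_add_le f hp
    have hv1 := hvar (i + 1) hi
    rw [hc] at hJ
    simp only [List.mem_cons, List.not_mem_nil, or_false] at hJ
    rcases hh with hh | hh <;> rcases hJ with rfl | rfl <;> rw [hh] at hv1 ⊢ <;> omega

theorem chain_finite_ncard_le (hrd : ∀ t, |(rd t : ℝ) - t| ≤ 1) (hf : f ≠ 0) {Y L : ℕ}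
    (hY : ∀ a b : ℝ, a < b → 2 ≤ var f a b → 1 ≤ 2 ^ Y * (b - a))
    (hL : 4096 * ((f.natDegree : ℝ) + 1) ^ 2 ≤ 2 ^ L) {J : Node} (hJ : IsSpecial rd f τ J) :
    (chain rd f τ J).Finite ∧
      (chain rd f τ J).ncard ≤ 16 * (Nat.log 2 (Y + τ + 2) + 1) + 3 * L + 21 := by
  obtain ⟨k, P, h0, rfl, hP⟩ := hJ.1.exists_path
  have hroot : (P 0).Proper := by rw [h0]; exact root_proper τ
  have hv : 2 ≤ (P k).var f := by
    have := hJ.2.1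
    unfold IsTerminal at this
    omega
  by_cases hne : ∃ i < k, ∀ j, i ≤ j → j < k → ¬ IsSpecial rd f τ (P j)
  swap
  · have hempty : chain rd f τ (P k) = ∅ := by
      rw [Set.eq_empty_iff_forall_notMem]
      intro I hI
      obtain ⟨i, hi, -, h⟩ := mem_chain h0 hP hJ hI
      exact hne ⟨i, hi, h⟩
    rw [hempty]
    simp
  classical
  -- The start of the last stretch of non-special nodes before `J`; the run considered is this
  -- stretch with `J` appended.
  set i₀ := Nat.find hne with hi₀
  obtain ⟨hik, hns⟩ := Nat.find_spec hne
  rw [← hi₀] at hik hns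
  have hsub : chain rd f τ (P k) ⊆ P '' (Finset.Ico i₀ k : Finset ℕ) := by
    intro I hI
    obtain ⟨i, hi, rfl, h⟩ := mem_chain h0 hP hJ hI
    refine ⟨i, ?_, rfl⟩
    simp only [Finset.coe_Ico, Set.mem_Ico]
    exact ⟨Nat.find_min' hne ⟨hi, h⟩, hi⟩
  have hfin : (P '' (Finset.Ico i₀ k : Finset ℕ)).Finite := (Finset.finite_toSet _).image _
  refine ⟨hfin.subset hsub, ?_⟩
  have hcard : (chain rd f τ (P k)).ncard ≤ k - i₀ := by
    refine (Set.ncard_le_ncard hsub hfin).trans ?_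
    refine (Set.ncard_image_le (Finset.finite_toSet _)).trans ?_
    rw [Set.ncard_coe_finset, Nat.card_Ico]
  refine hcard.trans ?_
  have hvar : ∀ j, j ≤ k - i₀ → (P (k - j)).var f = (P k).var f := by
    intro j
    induction j with
    | zero => intro _; rfl
    | succ j ih =>
      intro hj
      rw [← ih (by omega)]
      have := var_eq_of_not_isSpecial h0 hP hv (i := k - (j + 1)) (by omega)
        (hns _ (by omega) (by omega))
      rw [← this]
      congr 2
      omega
  refine run_length_le (Q := fun i => P (i₀ + i)) (rd := rd) (f := f) hrd hf
    (run_proper hroot hP _ (by omega)) ?_ ?_ ?_ ?_ hL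
  · intro i hi
    exact hP (i₀ + i) (by omega)
  · intro i hi
    have h1 := hvar (k - i₀ - i) (by omega)
    have e1 : k - (k - i₀ - i) = i₀ + i := by omega
    have e2 : i₀ + (k - i₀) = k := by omega
    rw [e1] at h1
    simp only [e2]
    exact h1
  · have e2 : i₀ + (k - i₀) = k := by omega
    simp only [e2]
    omega
  · intro i hi
    refine (path_inTree h0 hP (i₀ + i) (by omega)).lvl_le hY ?_
    obtain ⟨n1, n2, -⟩ := run_nested hroot hP (i := i₀ + i) k (by omega) le_rfl
    exact hv.trans (Node.var_le_of_le f (run_proper hroot hP k le_rfl).1 n1 n2)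

end Path

/-! ### Rounding rules and the final constant. -/

theorem abs_floor_sub_le (t : ℝ) : |(⌊t⌋ : ℝ) - t| ≤ 1 := by
  rw [abs_le]
  constructor <;> linarith [Int.floor_le t, Int.lt_floor_add_one t]

theorem abs_roundHalfDown_sub_le (t : ℝ) : |(roundHalfDown t : ℝ) - t| ≤ 1 := by
  unfold roundHalfDown
  rw [abs_le]
  constructor <;> linarith [Int.le_ceil (t - 1 / 2), Int.ceil_lt_add_one (t - 1 / 2)]

/-- Since `log n ≥ log 2`, the additive constants are absorbed even when `log τ = 0`. -/
theorem chain_bound_le {n τ : ℕ} (hn : 2 ≤ n) (hτ : 1 ≤ τ) :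
    ((16 * (Nat.log 2 (8 * τ * n ^ 2 + τ + 2) + 1) + 3 * (14 + 2 * Nat.log 2 n) + 21 : ℕ) : ℝ) ≤
      200 / Real.log 2 * (Real.log n + Real.log τ) := by
  have hlog2 : 0 < Real.log 2 := Real.log_pos (by norm_num)
  have hn' : (2 : ℝ) ≤ n := by exact_mod_cast hn
  have hτ' : (1 : ℝ) ≤ τ := by exact_mod_cast hτ
  have hln : Real.log 2 ≤ Real.log n := Real.log_le_log (by norm_num) hn'
  have hlτ : 0 ≤ Real.log τ := Real.log_nonneg hτ'
  have h1 : (Nat.log 2 n : ℝ) * Real.log 2 ≤ Real.log n := by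
    rw [← Real.log_pow]
    refine Real.log_le_log (by positivity) ?_
    exact_mod_cast Nat.pow_log_le_self 2 (by omega)
  have h2 : (Nat.log 2 (8 * τ * n ^ 2 + τ + 2) : ℝ) * Real.log 2 ≤
      4 * Real.log 2 + Real.log τ + 2 * Real.log n := by
    have e : 4 * Real.log 2 + Real.log τ + 2 * Real.log n = Real.log (2 ^ 4 * τ * n ^ 2) := by
      rw [Real.log_mul (by positivity) (by positivity),
        Real.log_mul (by positivity) (by positivity), Real.log_pow, Real.log_pow]
      norm_num
    rw [e, ← Real.log_pow]
    refine Real.log_le_log (by positivity) ?_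
    have h3 : 2 ^ Nat.log 2 (8 * τ * n ^ 2 + τ + 2) ≤ 8 * τ * n ^ 2 + τ + 2 :=
      Nat.pow_log_le_self 2 (by omega)
    have h4 : 8 * τ * n ^ 2 + τ + 2 ≤ 2 ^ 4 * τ * n ^ 2 := by
      have h5 : 2 ^ 2 ≤ n ^ 2 := Nat.pow_le_pow_left hn 2
      have := Nat.mul_le_mul_left τ h5
      nlinarith
    exact_mod_cast h3.trans h4
  rw [div_mul_eq_mul_div, le_div_iff₀ hlog2]
  push_cast at h1 h2 ⊢
  nlinarith

end

end Dsc2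

theorem mainTheorem3 :
    ∃ C : ℝ, ∀ (f : Polynomial ℤ) (τ : ℕ) (rd : ℝ → ℤ),
      Squarefree (f.map (Int.castRingHom ℚ)) →
      (∀ i, |f.coeff i| < 2 ^ τ) →
      (rd = Int.floor ∨ rd = Dsc2.roundHalfDown) →
      ∀ J : Dsc2.Node, Dsc2.IsSpecial rd (f.map (Int.castRingHom ℝ)) τ J →
        (Dsc2.chain rd (f.map (Int.castRingHom ℝ)) τ J).Finite ∧
          ((Dsc2.chain rd (f.map (Int.castRingHom ℝ)) τ J).ncard : ℝ) ≤
            C * (Real.log f.natDegree + Real.log τ) := by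
  refine ⟨200 / Real.log 2, ?_⟩
  intro f τ rd hsq hcoeff hrd J hJ
  have hrd' : ∀ t, |(rd t : ℝ) - t| ≤ 1 := by
    rcases hrd with rfl | rfl
    · exact Dsc2.abs_floor_sub_le
    · exact Dsc2.abs_roundHalfDown_sub_le
  have hinj : Function.Injective (Int.castRingHom ℝ) := Int.cast_injective
  have hf : f ≠ 0 := by
    rintro rfl
    rw [Polynomial.map_zero] at hsq
    exact not_squarefree_zero hsq
  have hf' : f.map (Int.castRingHom ℝ) ≠ 0 := (Polynomial.map_ne_zero_iff hinj).2 hf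
  have hdeg : (f.map (Int.castRingHom ℝ)).natDegree = f.natDegree :=
    Polynomial.natDegree_map_eq_of_injective hinj f
  -- For `τ = 0` the integer leading coefficient would vanish.
  have hτ : 1 ≤ τ := by
    by_contra h
    obtain rfl : τ = 0 := by omega
    have h1 := hcoeff f.natDegree
    rw [pow_zero, Int.abs_lt_one_iff] at h1
    exact hf (Polynomial.leadingCoeff_eq_zero.1 h1)
  -- A special node has at least two sign variations, hence there are at least two roots.
  have hn : 2 ≤ f.natDegree := by
    classical
    have h1 := hJ.2.1
    have h2 := Dsc2.var_le_countP hf' hJ.1.proper.1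
    have h3 := h2.trans (Multiset.countP_le_card _ _)
    rw [Dsc2.card_croots, hdeg] at h3
    unfold Dsc2.IsTerminal Dsc2.Node.var at h1
    omega
  have hL : 4096 * (((f.map (Int.castRingHom ℝ)).natDegree : ℝ) + 1) ^ 2 ≤
      2 ^ (14 + 2 * Nat.log 2 f.natDegree) := by
    rw [hdeg]
    have h1 : f.natDegree + 1 ≤ 2 ^ (Nat.log 2 f.natDegree + 1) :=
      Nat.lt_pow_succ_log_self (by norm_num) _
    have h2 : 4096 * (f.natDegree + 1) ^ 2 ≤ 2 ^ (14 + 2 * Nat.log 2 f.natDegree) :=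
      calc 4096 * (f.natDegree + 1) ^ 2 ≤ 4096 * (2 ^ (Nat.log 2 f.natDegree + 1)) ^ 2 := by
            gcongr
        _ = 2 ^ (14 + 2 * Nat.log 2 f.natDegree) := by
          rw [← pow_mul, show 4096 = 2 ^ 12 by norm_num, ← pow_add]; congr 1; ring
    exact_mod_cast h2
  obtain ⟨h1, h2⟩ := Dsc2.chain_finite_ncard_le hrd' hf'
    (fun a b hab hv => Dsc2.one_le_width_of_two_le_var hsq hτ hcoeff hab hv) hL hJ
  exact ⟨h1, (Nat.cast_le.2 h2).trans (Dsc2.chain_bound_le hn hτ)⟩
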